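/- Work over $\mathbb{C}$. For an irreducible closed subvariety $Z \subset \mathbb{P}^N$, let the dual variety $Z^\star \subset \mathbb{P}^{N\star}$ be the Zariski closure of the set of hyperplanes that contain the embedded projective tangent space of $Z$ at some smooth point of $Z$. A minimal defining polynomial of a hypersurface is a nonzero homogeneous polynomial of least degree having that hypersurface as its zero set; the degree of the hypersurface is the degree of such a polynomial. The class of a plane curve is the degree of its dual curve. Let $X \subset \mathbb{P}^3$ be an irreducible projective curve that is not a line. Then the dual variety $X^\star$ is a hypersurface in $\mathbb{P}^{3\star}$, and there is an integer $m$ such that: 1. every minimal defining polynomial $\Upsilon$ of $X^\star$ has degree $m$; 2. for a generic camera centre $O \in \mathbb{P}^3$ (that is, for all $O$ in some nonempty Zariski open subset of $\mathbb{P}^3$ depending only on $X$, disjoint from $X$) and every $3\times 4$ matrix $M$ of rank $3$ with $MO = 0$, the projection $Y = \{\,MP : P \in X\,\} \subset \mathbb{P}^2$ has as its dual $Y^\star$ a curve in $\mathbb{P}^{2\star}$, of degree $m$; that is, $Y$ has class $m$. So $\deg \Upsilon = m$, the common degree of the dual image curves. -/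

import Mathlib

open MvPolynomial
open scoped LinearAlgebra.Projectivization

namespace SpaceCurve

/-- The complex projective space with homogeneous coordinates indexed by `Fin n`, so of
dimension `n - 1`. The dual projective space of hyperplanes is written in the same coordinates:
`h` stands for the hyperplane `∑ i, h i * x i = 0`. -/
abbrev PSpace (n : ℕ) : Type := ℙ ℂ (Fin n → ℂ)

/-- The nonzero vectors representing the points of `Z`. -/
def cone {n : ℕ} (Z : Set (PSpace n)) : Set (Fin n → ℂ) :=
  {v | ∃ hv : v ≠ 0, Projectivization.mk ℂ v hv ∈ Z}

/-- The homogeneous ideal of `Z`. -/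
noncomputable def idealOf {n : ℕ} (Z : Set (PSpace n)) : Ideal (MvPolynomial (Fin n) ℂ) :=
  vanishingIdeal ℂ (cone Z)

/-- The homogeneous coordinate ring of `Z`. -/
abbrev CoordRing {n : ℕ} (Z : Set (PSpace n)) : Type :=
  MvPolynomial (Fin n) ℂ ⧸ idealOf Z

/-- The zero set in projective space of a (homogeneous) polynomial. -/
def zeroSet {n : ℕ} (F : MvPolynomial (Fin n) ℂ) : Set (PSpace n) :=
  {p | eval p.rep F = 0}

/-- The Zariski closure. -/
def zariskiClosure {n : ℕ} (Z : Set (PSpace n)) : Set (PSpace n) :=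
  {p | ∀ F ∈ idealOf Z, p ∈ zeroSet F}

/-- Irreducible projective curves: irreducible Zariski closed sets whose homogeneous coordinate
ring has Krull dimension `1 + 1`. -/
structure IsIrreducibleCurve {n : ℕ} (X : Set (PSpace n)) : Prop where
  closed : zariskiClosure X = X
  irreducible : (idealOf X).IsPrime
  dim_eq : ringKrullDim (CoordRing X) = 2

/-- The projective lines. -/
def IsLine {n : ℕ} (X : Set (PSpace n)) : Prop :=
  ∃ W : Submodule ℂ (Fin n → ℂ), Module.finrank ℂ W = 2 ∧ X = {p | p.rep ∈ W}

/-- The linear subspace of `ℂⁿ` whose projectivization is the embedded projective tangent space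
of `X` at `p`. -/
def tangentSpace {n : ℕ} (X : Set (PSpace n)) (p : PSpace n) : Submodule ℂ (Fin n → ℂ) where
  carrier := {w | ∀ F ∈ idealOf X, ∑ i, eval p.rep (pderiv i F) * w i = 0}
  zero_mem' := by
    intro F _
    simp
  add_mem' := by
    intro a b ha hb F hF
    simp only [Pi.add_apply, mul_add, Finset.sum_add_distrib, ha F hF, hb F hF, add_zero]
  smul_mem' := by
    intro c a ha F hF
    have h : ∑ i, eval p.rep (pderiv i F) * (c • a) i
        = c * ∑ i, eval p.rep (pderiv i F) * a i := by
      rw [Finset.mul_sum]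
      refine Finset.sum_congr rfl fun i _ => ?_
      simp only [Pi.smul_apply, smul_eq_mul]
      ring
    rw [h, ha F hF, mul_zero]

/-- Smooth points of an irreducible variety `X`: the projective tangent space has the dimension
of `X` (both sides are one more than the projective dimensions). -/
def IsSmoothPoint {n : ℕ} (X : Set (PSpace n)) (p : PSpace n) : Prop :=
  p ∈ X ∧ (Module.finrank ℂ (tangentSpace X p) : WithBot ℕ∞) = ringKrullDim (CoordRing X)

/-- The hyperplanes that contain the projective tangent space at some smooth point of `X`. -/
def tangentHyperplanes {n : ℕ} (X : Set (PSpace n)) : Set (PSpace n) :=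
  {h | ∃ p, IsSmoothPoint X p ∧ ∀ w ∈ tangentSpace X p, ∑ i, h.rep i * w i = 0}

/-- The dual variety of an irreducible variety `X`. -/
def dualVariety {n : ℕ} (X : Set (PSpace n)) : Set (PSpace n) :=
  zariskiClosure (tangentHyperplanes X)

/-- `F` is a nonzero homogeneous polynomial whose zero set is `Z`. -/
structure IsDefiningPolynomial {n : ℕ} (F : MvPolynomial (Fin n) ℂ) (Z : Set (PSpace n)) :
    Prop where
  ne_zero : F ≠ 0
  homogeneous : F.IsHomogeneous F.totalDegree
  zeroSet_eq : zeroSet F = Z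

/-- `F` is a polynomial of minimal degree representing `Z`. -/
structure IsMinimalDefiningPolynomial {n : ℕ} (F : MvPolynomial (Fin n) ℂ)
    (Z : Set (PSpace n)) : Prop extends IsDefiningPolynomial F Z where
  minimal : ∀ G, IsDefiningPolynomial G Z → F.totalDegree ≤ G.totalDegree

/-- `Z` is the zero set of a nonconstant homogeneous polynomial. -/
def IsHypersurface {n : ℕ} (Z : Set (PSpace n)) : Prop :=
  ∃ F, IsDefiningPolynomial F Z ∧ 0 < F.totalDegree

/-- The degree of a hypersurface (in the plane: of a curve) is the degree of its minimal defining
polynomial. -/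
noncomputable def hypersurfaceDegree {n : ℕ} (Z : Set (PSpace n)) : ℕ :=
  sInf {k | ∃ F, IsDefiningPolynomial F Z ∧ F.totalDegree = k}

/-- The class of a plane curve: the degree of its dual curve. -/
noncomputable def curveClass (Y : Set (PSpace 3)) : ℕ :=
  hypersurfaceDegree (dualVariety Y)

/-- The projection of `X` to the plane by the camera matrix `M`. -/
def imageCurve (M : Matrix (Fin 3) (Fin 4) ℂ) (X : Set (PSpace 4)) : Set (PSpace 3) :=
  {q | ∃ v ∈ cone X, ∃ h : M.mulVec v ≠ 0, q = Projectivization.mk ℂ (M.mulVec v) h}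

end SpaceCurve

/-! A line `y` of the image plane pulls back to the plane `Mᵀ y` through the centre `O`, and for
general `O` the tangent lines of `Y` come from the planes through `O` that are tangent to `X`. So
`Y^⋆` is the section of `X^⋆` by the planes through `O`. If `F` generates the ideal of `X^⋆`, it
remains to see that `F ∘ Mᵀ` generates the ideal of `Y^⋆`: a nonzero linear restriction of a form
keeps its degree.

The dual surface (`exists_isDualEquation`). A conormal vector `h` at the generic point `x` of `X`,
with independent parameters, is a generic point of `X^⋆`. Tangent vectors at generic points are
values of derivations (`exists_derivation_apply_eq`), and their number bounds the Krull dimension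
from below. If the tangent space of the cone over `X^⋆` at `h` had dimension at most 2,
differentiating `h ⬝ τ = 0` would make the tangent line constant and `X` a line. So the cone has
dimension 3 and its ideal is generated by a prime `F`. Differentiating `h ⬝ x = 0` gives biduality:
`∇F(h)` is proportional to `x`, so the gradient of `F` recovers the point of contact.

The section (`idealOf_tangentHyperplanes_imageCurve`). Let `g` be nonzero only at good points of
`X`. The locus `F = g(∇F) = 0` is a proper part of the surface, and for general `O` no component of
the section lies in it (`IsDualEquation.not_dvd_linSubst`). Off this locus `∇(F ∘ Mᵀ)(y) = M ∇F(Mᵀ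
y)` is the image of the contact point, nonzero since `O ∉ X`; hence `F ∘ Mᵀ` is squarefree. There
`y` also annihilates `M p` and `M τ(p)`, which are independent because `O` avoids the tangent lines,
so `y` is a tangent line of `Y`. Every equation of `Y^⋆` is therefore divisible by every prime
factor of `F ∘ Mᵀ`. -/

section DimensionAndDerivations

/-! ### Krull dimension, derivations and generic tangent vectors. -/

theorem natCast_le_ringKrullDim_of_integral {k : Type*} [Field k] (s : ℕ) :
    ∀ {A : Type*} [CommRing A] [IsDomain A] (φ : MvPolynomial (Fin s) k →+* A),
      Function.Injective φ → φ.IsIntegral → (s : WithBot ℕ∞) ≤ ringKrullDim A := by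
  induction s with
  | zero =>
    intro A _ _ φ _ _
    simpa using ringKrullDim_nonneg_of_nontrivial (R := A)
  | succ s ih =>
    intro A _ _ φ hinj hint
    -- `e` kills the first variable and `r` is a section of it. A prime `P` over `ker e` contains
    -- the nonzero `φ (X 0)`, and `A ⧸ P` is integral over one variable fewer.
    let e : MvPolynomial (Fin (s + 1)) k →ₐ[k] MvPolynomial (Fin s) k :=
      aeval (Fin.cons 0 X)
    let r : MvPolynomial (Fin s) k →ₐ[k] MvPolynomial (Fin (s + 1)) k := rename Fin.succ
    have her : ∀ p, e (r p) = p := by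
      intro p
      simp only [e, r, aeval_rename]
      have : (Fin.cons 0 X : Fin (s + 1) → MvPolynomial (Fin s) k) ∘ Fin.succ = X := by
        ext i; simp
      rw [this, aeval_X_left_apply]
    algebraize [φ]
    have hker : RingHom.ker (algebraMap (MvPolynomial (Fin (s + 1)) k) A) ≤
        RingHom.ker e.toRingHom := by
      change RingHom.ker φ ≤ _
      rw [(RingHom.injective_iff_ker_eq_bot φ).mp hinj]
      exact bot_le
    have : (RingHom.ker e.toRingHom).IsPrime := RingHom.ker_isPrime _
    obtain ⟨P, hP, hPe⟩ := Ideal.exists_ideal_over_prime_of_isIntegral_of_isDomain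
      (S := A) (RingHom.ker e.toRingHom) hker
    have hmem : ∀ p, φ p ∈ P ↔ e p = 0 := by
      intro p
      exact SetLike.ext_iff.mp hPe p
    let ψ : MvPolynomial (Fin s) k →+* A ⧸ P := (Ideal.Quotient.mk P).comp (φ.comp r.toRingHom)
    have hψ : Function.Injective ψ := by
      rw [injective_iff_map_eq_zero]
      intro p hp
      have : φ (r p) ∈ P := Ideal.Quotient.eq_zero_iff_mem.mp hp
      rw [hmem, her] at this
      exact this
    have hcomp : ψ.comp e.toRingHom = (Ideal.Quotient.mk P).comp φ := by
      refine RingHom.ext fun p => ?_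
      change Ideal.Quotient.mk P (φ (r (e p))) = Ideal.Quotient.mk P (φ p)
      rw [Ideal.Quotient.eq, ← map_sub, hmem, map_sub, her, sub_self]
    have hψint : ψ.IsIntegral := by
      refine RingHom.IsIntegral.tower_top e.toRingHom ψ ?_
      rw [hcomp]
      exact hint.trans _ _ (RingHom.isIntegral_of_surjective _ Ideal.Quotient.mk_surjective)
    have h1 := ih ψ hψ hψint
    have hX : φ (X 0) ∈ P := by
      rw [hmem]; simp [e]
    have h2 := ringKrullDim_succ_le_of_surjective (Ideal.Quotient.mk P)
      Ideal.Quotient.mk_surjective (r := φ (X 0))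
      (mem_nonZeroDivisors_of_ne_zero (by
        rw [Ne, map_eq_zero_iff φ hinj]; exact X_ne_zero 0))
      (Ideal.Quotient.eq_zero_iff_mem.mpr hX)
    refine le_trans ?_ h2
    push_cast
    gcongr

/-- The Krull dimension of a finitely generated domain bounds the number of algebraically
independent elements. -/
theorem AlgebraicIndependent.natCast_le_ringKrullDim {k A : Type} [Field k] [CommRing A]
    [IsDomain A] [Algebra k A] [Algebra.FiniteType k A] {r : ℕ} {y : Fin r → A}
    (hy : AlgebraicIndependent k y) : (r : WithBot ℕ∞) ≤ ringKrullDim A := by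
  obtain ⟨s, φ, hinj, hint⟩ := exists_integral_inj_algHom_of_fg k A
  have hs := natCast_le_ringKrullDim_of_integral s φ.toRingHom hinj hint
  have hz : AlgebraicIndependent k (fun i => φ (X i)) := by
    have : (aeval fun i => φ (X i)) = φ := by ext; simp
    rw [AlgebraicIndependent, this]; exact hinj
  have hrange : ∀ p, φ p ∈ Algebra.adjoin k (Set.range fun i => φ (X i)) := by
    intro p
    rw [Algebra.adjoin_range_eq_range_aeval]
    refine ⟨p, ?_⟩
    change (aeval fun i => φ (X i)) p = φ p
    congr 1; ext; simp
  -- `A` is integral over the normalization variables, so `s` is its transcendence degree and `r ≤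
  -- s`.
  have hbasis : IsTranscendenceBasis k (fun i => φ (X i)) := by
    rw [hz.isTranscendenceBasis_iff_isAlgebraic]
    have : Algebra.IsIntegral (Algebra.adjoin k (Set.range fun i => φ (X i))) A := by
      refine ⟨fun a => ?_⟩
      obtain ⟨p, hp, hpa⟩ := hint a
      refine ⟨p.map (φ.toRingHom.codRestrict (Algebra.adjoin k (Set.range fun i => φ (X i)))
        hrange), hp.map _, ?_⟩
      rw [Polynomial.eval₂_map]
      exact hpa
    infer_instance
  have h1 := hy.cardinalMk_le_trdeg
  rw [← hbasis.cardinalMk_eq_trdeg] at h1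
  simp only [Cardinal.mk_fin, Nat.cast_le] at h1
  refine le_trans ?_ hs
  exact_mod_cast h1

/-- In characteristic zero `L` is separable algebraic over a purely transcendental extension of `E`,
hence formally smooth, so it lifts through the square-zero kernel of `g`. -/
theorem exists_ringHom_section_of_charZero {E L B : Type*} [Field E] [CharZero E] [Field L]
    [CommRing B] (i : E →+* L) (j : E →+* B) (g : B →+* L) (hg : ∀ e, g (j e) = i e)
    (hsurj : Function.Surjective g) (hnil : ∀ x y, g x = 0 → g y = 0 → x * y = 0) :
    ∃ σ : L →+* B, (∀ x, g (σ x) = x) ∧ ∀ e, σ (i e) = j e := by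
  let _ := i.toAlgebra
  let _ := j.toAlgebra
  obtain ⟨s, hs⟩ := exists_isTranscendenceBasis E L
  have := hs.isAlgebraic_field
  have : CharZero (IntermediateField.adjoin E (Set.range ((↑) : s → L))) :=
    charZero_of_injective_algebraMap
      (algebraMap E (IntermediateField.adjoin E (Set.range ((↑) : s → L)))).injective
  have := Algebra.FormallySmooth.of_algebraicIndependent_of_isSeparable hs.1
  let g' : B →ₐ[E] L := { g with commutes' := hg }
  have hnil' : IsNilpotent (RingHom.ker (g' : B →+* L)) := by
    refine ⟨2, ?_⟩
    rw [pow_two, Ideal.zero_eq_bot, eq_bot_iff, Ideal.mul_le]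
    intro x hx y hy
    simpa using hnil x y hx hy
  let σ := Algebra.FormallySmooth.liftOfSurjective (AlgHom.id E L) g' hsurj hnil'
  refine ⟨σ, fun x => ?_, fun e => σ.commutes e⟩
  exact Algebra.FormallySmooth.liftOfSurjective_apply (AlgHom.id E L) g' hsurj hnil' x

/-- By hypothesis `f ↦ f(v + εw)` factors through `k[v]`. It extends to the fraction field, and then
to `L` by formal smoothness; the `ε`-part of the lift is the derivation. -/
theorem exists_derivation_apply_eq {k L : Type*} [Field k] [CharZero k] [Field L] [Algebra k L]
    {n : ℕ} (v w : Fin n → L)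
    (h : ∀ f : MvPolynomial (Fin n) k, aeval v f = 0 → ∑ i, aeval v (pderiv i f) * w i = 0) :
    ∃ D : Derivation k L L, ∀ i, D (v i) = w i := by
  let φ : MvPolynomial (Fin n) k →ₐ[k] TrivSqZeroExt L L :=
    aeval fun i => TrivSqZeroExt.inl (v i) + TrivSqZeroExt.inr (w i)
  have hfst : ∀ f, (φ f).fst = aeval v f := by
    intro f
    have : (TrivSqZeroExt.fstHom k L L).comp φ = aeval v := by ext i; simp [φ]
    exact DFunLike.congr_fun this f
  have hsnd : ∀ f, (φ f).snd = ∑ i, aeval v (pderiv i f) * w i := by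
    intro f
    induction f using MvPolynomial.induction_on with
    | C a => simp [φ, TrivSqZeroExt.algebraMap_eq_inl']
    | add p q hp hq => simp [hp, hq, add_mul, Finset.sum_add_distrib]
    | mul_X p i hp =>
      have hX : φ (X i) = TrivSqZeroExt.inl (v i) + TrivSqZeroExt.inr (w i) := by simp [φ]
      simp only [map_mul, TrivSqZeroExt.snd_mul, hp, hfst, hX, Derivation.leibniz, pderiv_X,
        TrivSqZeroExt.snd_add, TrivSqZeroExt.snd_inl, TrivSqZeroExt.snd_inr, map_add,
        TrivSqZeroExt.fst_add, TrivSqZeroExt.fst_inl, TrivSqZeroExt.fst_inr, smul_eq_mul,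
        aeval_X, add_mul, Finset.sum_add_distrib, zero_add, add_zero, MulOpposite.smul_eq_mul_unop,
        MulOpposite.unop_op]
      congr 1
      · rw [Finset.sum_eq_single i]
        · simp
        · intro b _ hb; simp [hb]
        · simp
      · rw [Finset.sum_mul]
        exact Finset.sum_congr rfl fun j _ => by ring
  let I := RingHom.ker (aeval v : MvPolynomial (Fin n) k →ₐ[k] L)
  have hker : ∀ f ∈ I, φ f = 0 := by
    intro f hf
    have hf' : aeval v f = 0 := hf
    ext
    · rw [hfst, hf']; rfl
    · rw [hsnd, h f hf']; rfl
  have : I.IsPrime := RingHom.ker_isPrime _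
  let A := MvPolynomial (Fin n) k ⧸ I
  let iA : A →+* L := RingHom.kerLift (aeval v : MvPolynomial (Fin n) k →ₐ[k] L).toRingHom
  have hiA : Function.Injective iA := RingHom.kerLift_injective _
  let jA : A →+* TrivSqZeroExt L L := Ideal.Quotient.lift I φ.toRingHom hker
  have hij : ∀ a, (jA a).fst = iA a := by
    intro a
    obtain ⟨f, rfl⟩ := Ideal.Quotient.mk_surjective a
    exact hfst f
  let E := FractionRing A
  have hunit : ∀ a : nonZeroDivisors A, IsUnit (jA a) := by
    intro a
    rw [TrivSqZeroExt.isUnit_iff_isUnit_fst, hij, isUnit_iff_ne_zero, Ne,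
      map_eq_zero_iff iA hiA]
    exact nonZeroDivisors.ne_zero a.2
  let i : E →+* L := IsFractionRing.lift hiA
  let j : E →+* TrivSqZeroExt L L := IsLocalization.lift hunit
  have hi : ∀ f, i (algebraMap A E (Ideal.Quotient.mk I f)) = aeval v f :=
    fun f => IsFractionRing.lift_algebraMap hiA _
  have hj : ∀ f, j (algebraMap A E (Ideal.Quotient.mk I f)) = φ f :=
    fun f => IsLocalization.lift_eq hunit _
  let g : TrivSqZeroExt L L →+* L := (TrivSqZeroExt.fstHom L L L).toRingHom
  have hg : ∀ e, g (j e) = i e := by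
    have : g.comp j = i := by
      refine IsLocalization.ringHom_ext (nonZeroDivisors A) (RingHom.ext fun a => ?_)
      obtain ⟨f, rfl⟩ := Ideal.Quotient.mk_surjective a
      simp only [RingHom.comp_apply, hi, hj]
      exact hfst f
    exact DFunLike.congr_fun this
  have : CharZero E := by
    have : CharZero A := charZero_of_injective_ringHom (algebraMap k A).injective
    exact charZero_of_injective_algebraMap (IsFractionRing.injective A E)
  obtain ⟨σ, hσ, hσj⟩ := exists_ringHom_section_of_charZero i j g hg
    (fun x => ⟨TrivSqZeroExt.inl x, rfl⟩) (fun x y hx hy => by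
      have hx' : x.fst = 0 := hx
      have hy' : y.fst = 0 := hy
      ext <;> simp [hx', hy'])
  have hσf : ∀ f, σ (aeval v f) = φ f := fun f => by rw [← hi, hσj, hj]
  have hσ1 : ∀ x, (σ x).fst = x := hσ
  have hσk : ∀ c : k, σ (algebraMap k L c) = TrivSqZeroExt.inl (algebraMap k L c) := by
    intro c
    have := hσf (C c)
    simpa [φ, TrivSqZeroExt.algebraMap_eq_inl'] using this
  let D : L →ₗ[k] L :=
    { toFun := fun x => (σ x).snd
      map_add' := fun x y => by simp
      map_smul' := fun c x => by
        simp [Algebra.smul_def, hσk, hσ1] }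
  refine ⟨Derivation.mk' D fun a b => ?_, fun i => ?_⟩
  · simp [D, hσ1, mul_comm b]
  · have := hσf (X i)
    simp only [aeval_X] at this
    simp [D, this, φ]

/-- A transcendental `u` admits a derivation with `D u = 1`, and an algebraic one already lies in
`k`. -/
theorem mem_range_algebraMap_of_derivation_eq_zero {k L : Type*} [Field k] [CharZero k]
    [IsAlgClosed k] [Field L] [Algebra k L] (u : L) (h : ∀ D : Derivation k L L, D u = 0) :
    ∃ c : k, algebraMap k L c = u := by
  by_cases hu : IsAlgebraic k u
  · have hirr := minpoly.irreducible hu.isIntegral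
    exact minpoly.mem_range_of_degree_eq_one k u (IsAlgClosed.degree_eq_one_of_irreducible k hirr)
  · exfalso
    have hind : AlgebraicIndependent k (fun _ : Fin 1 => u) :=
      algebraicIndependent_unique_type_iff.mpr hu
    obtain ⟨D, hD⟩ := exists_derivation_apply_eq (k := k) (fun _ : Fin 1 => u) (fun _ => 1)
      (fun f hf => by
        rw [(injective_iff_map_eq_zero _).mp hind f hf]; simp)
    have := hD 0
    rw [h D] at this
    exact zero_ne_one this

theorem Derivation.apply_aeval_mvPolynomial {k L : Type*} [Field k] [Field L] [Algebra k L]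
    {n : ℕ} (D : Derivation k L L) (v : Fin n → L) (f : MvPolynomial (Fin n) k) :
    D (aeval v f) = ∑ i, aeval v (pderiv i f) * D (v i) := by
  induction f using MvPolynomial.induction_on with
  | C a => simp
  | add p q hp hq => simp [hp, hq, add_mul, Finset.sum_add_distrib]
  | mul_X p i hp =>
    simp only [map_mul, Derivation.leibniz, hp, aeval_X, pderiv_X, smul_eq_mul, map_add, add_mul,
      Finset.sum_add_distrib]
    congr 1
    · rw [Finset.sum_eq_single i]
      · simp
      · intro b _ hb; simp [hb]
      · simp
    · rw [Finset.mul_sum]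
      exact Finset.sum_congr rfl fun j _ => by ring

/-- The field of constants of a derivation. -/
def Derivation.constants {k L : Type*} [Field k] [Field L] [Algebra k L]
    (D : Derivation k L L) : IntermediateField k L where
  carrier := {x | D x = 0}
  mul_mem' := fun {a b} ha hb => by
    simp only [Set.mem_ofPred_eq] at ha hb ⊢
    simp [ha, hb]
  add_mem' := fun {a b} ha hb => by
    simp only [Set.mem_ofPred_eq] at ha hb ⊢
    simp [ha, hb]
  algebraMap_mem' := fun c => by simp
  inv_mem' := fun a ha => by
    simp only [Set.mem_ofPred_eq] at ha ⊢
    simp [Derivation.leibniz_inv, ha]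

/-- Over the field of constants the minimal polynomial `p` of `u` is separable, and `0 = D (p(u)) =
p'(u) D u`. -/
theorem Derivation.apply_eq_zero_of_isAlgebraic {k L : Type*} [Field k] [CharZero k] [Field L]
    [Algebra k L] (D : Derivation k L L) (S : Subalgebra k L) (hS : ∀ x ∈ S, D x = 0) (u : L)
    (hu : IsAlgebraic S u) : D u = 0 := by
  let F := D.constants
  let DF : Derivation F L L := Derivation.mk'
    { toFun := D
      map_add' := D.map_add
      map_smul' := fun c x => by
        have : D (c : L) = 0 := c.2
        simp [Algebra.smul_def, this] } (fun a b => D.leibniz a b)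
  have huF : IsAlgebraic F u := by
    obtain ⟨p, hp, hpu⟩ := hu
    let ι : S →+* F := Subring.inclusion (S := S.toSubring) (T := F.toSubring) hS
    have hι : Function.Injective ι := Subring.inclusion_injective _
    refine ⟨p.map ι, (Polynomial.map_ne_zero_iff hι).mpr hp, ?_⟩
    rw [Polynomial.aeval_def, Polynomial.eval₂_map]
    exact hpu
  have : CharZero F := charZero_of_injective_algebraMap (algebraMap k F).injective
  have hsep : (minpoly F u).Separable := (minpoly.irreducible huF.isIntegral).separable
  have h1 := DF.map_aeval (minpoly F u) u
  rw [minpoly.aeval, map_zero, smul_eq_mul] at h1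
  exact (mul_eq_zero.mp h1.symm).resolve_left
    (hsep.aeval_derivative_ne_zero (minpoly.aeval F u))

/-- The dimension of the space of tangent vectors at the generic point is at most the Krull
dimension. -/
theorem LinearIndependent.natCast_le_ringKrullDim_quotient {k L : Type} [Field k] [CharZero k]
    [Field L] [Algebra k L] {n r : ℕ} (v : Fin n → L) (J : Ideal (MvPolynomial (Fin n) k))
    (hJ : ∀ f, f ∈ J ↔ aeval v f = 0) (w : Fin r → Fin n → L) (hw : LinearIndependent L w)
    (h : ∀ a, ∀ f : MvPolynomial (Fin n) k, aeval v f = 0 →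
      ∑ i, aeval v (pderiv i f) * w a i = 0) :
    (r : WithBot ℕ∞) ≤ ringKrullDim (MvPolynomial (Fin n) k ⧸ J) := by
  classical
  -- A maximal algebraically independent set of coordinates; every other coordinate is algebraic
  -- over it.
  obtain ⟨s, hs⟩ := Set.Finite.exists_maximal
    (Set.toFinite {s : Set (Fin n) | AlgebraicIndepOn k v s}) ⟨∅, by
      have : IsEmpty ((∅ : Set (Fin n)) : Type) := Set.isEmpty_coe_sort.mpr rfl
      exact (algebraicIndependent_empty_type_iff
        (x := fun i : (∅ : Set (Fin n)) => v i)).mpr (algebraMap k L).injective⟩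
  have halg : ∀ j, IsAlgebraic (Algebra.adjoin k (v '' s)) (v j) := by
    intro j
    by_cases hj : j ∈ s
    · exact isAlgebraic_algebraMap
        (⟨v j, Algebra.subset_adjoin ⟨j, hj, rfl⟩⟩ : Algebra.adjoin k (v '' s))
    · by_contra hcon
      have : AlgebraicIndepOn k v (insert j s) :=
        (AlgebraicIndepOn.insert_iff hj).mpr ⟨hs.1, hcon⟩
      exact hj (hs.2 this (Set.subset_insert j s) (Set.mem_insert j s))
  -- Projecting tangent vectors to the coordinates in `s` loses nothing: a combination vanishing
  -- there extends to a derivation that kills `v '' s`, hence every `v j`.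
  have hind : LinearIndependent L (fun a => fun i : s => w a i) := by
    rw [Fintype.linearIndependent_iff] at hw ⊢
    intro c hc
    refine hw c ?_
    obtain ⟨D, hD⟩ := exists_derivation_apply_eq (k := k) v (∑ a, c a • w a) (by
      intro f hf
      simp only [Finset.sum_apply, Pi.smul_apply, smul_eq_mul, Finset.mul_sum]
      rw [Finset.sum_comm]
      refine Finset.sum_eq_zero fun a _ => ?_
      have := h a f hf
      calc _ = c a * ∑ i, aeval v (pderiv i f) * w a i := by
            rw [Finset.mul_sum]; exact Finset.sum_congr rfl fun i _ => by ring
        _ = 0 := by rw [this, mul_zero])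
    ext j
    rw [← hD j]
    refine D.apply_eq_zero_of_isAlgebraic _ (fun x hx => ?_) _ (halg j)
    have hle : Algebra.adjoin k (v '' s) ≤ D.constants.toSubalgebra := by
      rw [Algebra.adjoin_le_iff]
      rintro _ ⟨i, hi, rfl⟩
      change D (v i) = 0
      rw [hD]
      have := congrFun hc ⟨i, hi⟩
      simpa using this
    exact hle hx
  have hcard := hind.fintype_card_le_finrank
  simp only [Fintype.card_fin, Module.finrank_fintype_fun_eq_card] at hcard
  have hprime : J.IsPrime := by
    have : J = RingHom.ker (aeval v : MvPolynomial (Fin n) k →ₐ[k] L) := by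
      ext f; rw [hJ]; rfl
    rw [this]; exact RingHom.ker_isPrime _
  let ψ : (MvPolynomial (Fin n) k ⧸ J) →ₐ[k] L :=
    Ideal.Quotient.liftₐ J (aeval v) (fun f hf => (hJ f).mp hf)
  let e := Fintype.equivFin s
  have hy : AlgebraicIndependent k
      (fun a : Fin (Fintype.card s) => Ideal.Quotient.mk J (X ((e.symm a : s) : Fin n))) := by
    refine AlgebraicIndependent.of_comp ψ ?_
    have h1 : AlgebraicIndependent k (fun i : s => v i) := hs.1
    have h2 : ψ ∘ (fun a : Fin (Fintype.card s) =>
        Ideal.Quotient.mk J (X ((e.symm a : s) : Fin n))) = (fun i : s => v i) ∘ e.symm := by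
      ext a
      exact aeval_X v _
    rw [h2]
    exact h1.comp _ e.symm.injective
  refine le_trans ?_ hy.natCast_le_ringKrullDim
  exact_mod_cast hcard

end DimensionAndDerivations

/-! ### Homogeneous components on lines through the origin. -/

section Homogeneity

theorem MvPolynomial.IsHomogeneous.aeval_mul {k R : Type*} [Field k] [CommRing R] [Algebra k R]
    {σ : Type*} {f : MvPolynomial σ k} {d : ℕ} (hf : f.IsHomogeneous d) (c : R)
    (v : σ → R) : MvPolynomial.aeval (fun i => c * v i) f = c ^ d * MvPolynomial.aeval v f := by
  rw [aeval_def, aeval_def, eval₂_eq, eval₂_eq, Finset.mul_sum]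
  refine Finset.sum_congr rfl fun m hm => ?_
  have hd : ∑ i ∈ m.support, m i = d := (hf.degree_eq_sum_deg_support hm).symm
  simp only [mul_pow, Finset.prod_mul_distrib, Finset.prod_pow_eq_pow_sum, hd]
  ring

theorem MvPolynomial.aeval_mul_eq_sum {k R : Type*} [Field k] [CommRing R] [Algebra k R]
    {σ : Type*} (f : MvPolynomial σ k) (c : R) (v : σ → R) :
    aeval (fun i => c * v i) f =
      ∑ d ∈ Finset.range (f.totalDegree + 1), c ^ d * aeval v (homogeneousComponent d f) := by
  conv_lhs => rw [← sum_homogeneousComponent f]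
  rw [map_sum]
  exact Finset.sum_congr rfl fun d _ => (homogeneousComponent_isHomogeneous d f).aeval_mul c v

/-- A polynomial vanishing on a punctured line through the origin has all its homogeneous
components vanishing there. -/
theorem MvPolynomial.eval_homogeneousComponent_eq_zero {k σ : Type*} [Field k] [Infinite k]
    (f : MvPolynomial σ k) (v : σ → k) (h : ∀ c : k, c ≠ 0 → aeval (fun i => c * v i) f = 0)
    (d : ℕ) : aeval v (homogeneousComponent d f) = 0 := by
  let P : Polynomial k := ∑ d ∈ Finset.range (f.totalDegree + 1),
    Polynomial.C (aeval v (homogeneousComponent d f)) * Polynomial.X ^ d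
  have hP : P = 0 := by
    refine Polynomial.eq_zero_of_infinite_isRoot P
      (Set.Infinite.mono (s := {0}ᶜ) (fun c hc => ?_) (Set.finite_singleton 0).infinite_compl)
    have := h c hc
    rw [aeval_mul_eq_sum] at this
    change P.eval c = 0
    rw [← this, Polynomial.eval_finsetSum]
    exact Finset.sum_congr rfl fun d _ => by
      rw [Polynomial.eval_mul, Polynomial.eval_C, Polynomial.eval_pow, Polynomial.eval_X, mul_comm]
  by_cases hd : d ≤ f.totalDegree
  · have := congrArg (fun q => Polynomial.coeff q d) hP
    simpa [P, Polynomial.finsetSum_coeff, Polynomial.coeff_X_pow, Nat.lt_succ_iff, hd] using this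
  · rw [homogeneousComponent_eq_zero _ _ (not_le.mp hd), map_zero]

end Homogeneity

/-- The gradient of a polynomial at a point. -/
noncomputable def gradAt {k R : Type*} [Field k] [CommRing R] [Algebra k R] {n : ℕ}
    (v : Fin n → R) (f : MvPolynomial (Fin n) k) : Fin n → R :=
  fun i => aeval v (pderiv i f)

/-! ### Gradients, Euler's relation and double orthogonals. -/

section Gradient

variable {k R : Type*} [Field k] [CommRing R] [Algebra k R] {n : ℕ}

@[simp]
theorem gradAt_apply (v : Fin n → R) (f : MvPolynomial (Fin n) k) (i : Fin n) :
    gradAt v f i = aeval v (pderiv i f) := rfl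

theorem gradAt_add (v : Fin n → R) (f g : MvPolynomial (Fin n) k) :
    gradAt v (f + g) = gradAt v f + gradAt v g := by ext; simp

theorem gradAt_mul (v : Fin n → R) (f g : MvPolynomial (Fin n) k) :
    gradAt v (f * g) = aeval v f • gradAt v g + aeval v g • gradAt v f := by
  ext; simp

theorem gradAt_sum {ι : Type*} (s : Finset ι) (v : Fin n → R) (f : ι → MvPolynomial (Fin n) k) :
    gradAt v (∑ a ∈ s, f a) = ∑ a ∈ s, gradAt v (f a) := by
  ext; simp

theorem gradAt_mul_of_isHomogeneous {f : MvPolynomial (Fin n) k} {d : ℕ}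
    (hf : f.IsHomogeneous (d + 1)) (c : R) (v : Fin n → R) :
    gradAt (fun i => c * v i) f = c ^ d • gradAt v f := by
  ext i
  simp [(hf.pderiv (i := i)).aeval_mul c v]

theorem gradAt_homogeneousComponent_zero (v : Fin n → R) (f : MvPolynomial (Fin n) k) :
    gradAt v (homogeneousComponent 0 f) = 0 := by
  ext i; simp [homogeneousComponent_zero]

theorem gradAt_eq_sum_homogeneousComponent (v : Fin n → R) (f : MvPolynomial (Fin n) k) :
    gradAt v f = ∑ d ∈ Finset.range (f.totalDegree + 1), gradAt v (homogeneousComponent d f) := by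
  rw [← gradAt_sum, sum_homogeneousComponent]

theorem dotProduct_gradAt_of_isHomogeneous {f : MvPolynomial (Fin n) k} {d : ℕ}
    (hf : f.IsHomogeneous d) (v : Fin n → R) :
    gradAt v f ⬝ᵥ v = d * aeval v f := by
  have := congrArg (aeval v) hf.sum_X_mul_pderiv
  simp only [map_sum, map_mul, aeval_X, nsmul_eq_mul, map_natCast] at this
  rw [← this]
  exact Finset.sum_congr rfl fun i _ => mul_comm _ _

theorem Derivation.apply_aeval_eq_dotProduct {k L : Type*} [Field k] [Field L] [Algebra k L]
    {n : ℕ} (D : Derivation k L L) (v : Fin n → L) (f : MvPolynomial (Fin n) k) :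
    D (aeval v f) = gradAt v f ⬝ᵥ fun i => D (v i) :=
  D.apply_aeval_mvPolynomial v f

theorem mem_of_forall_dotProduct_eq_zero {L : Type*} [Field L] {n : ℕ}
    (N : Submodule L (Fin n → L)) (h : Fin n → L)
    (hN : ∀ w, (∀ u ∈ N, u ⬝ᵥ w = 0) → h ⬝ᵥ w = 0) : h ∈ N := by
  by_contra hcon
  obtain ⟨φ, hφ, hφN⟩ := Submodule.exists_dual_map_eq_bot_of_notMem hcon inferInstance
  have hrep : ∀ u, φ u = u ⬝ᵥ fun i => φ (Pi.single i 1) := by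
    intro u
    conv_lhs => rw [pi_eq_sum_univ' u, map_sum]
    exact Finset.sum_congr rfl fun i _ => by simp
  refine hφ ?_
  rw [hrep]
  refine hN _ fun u hu => ?_
  rw [← hrep]
  exact (Submodule.eq_bot_iff _).mp hφN _ ⟨u, hu, rfl⟩

end Gradient

/-! ### Linear substitutions and the chain rule. -/

section LinearSubstitution

variable {k R : Type*} [Field k] [CommRing R] [Algebra k R] {m n : ℕ}

/-- The substitution of the linear forms given by the rows of a matrix. -/
noncomputable def linSubst (M : Matrix (Fin m) (Fin n) k) :
    MvPolynomial (Fin m) k →ₐ[k] MvPolynomial (Fin n) k :=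
  aeval fun i => ∑ j, C (M i j) * X j

theorem aeval_linSubst (M : Matrix (Fin m) (Fin n) k) (v : Fin n → R)
    (f : MvPolynomial (Fin m) k) :
    aeval v (linSubst M f) = aeval ((M.map (algebraMap k R)).mulVec v) f := by
  rw [linSubst, ← AlgHom.comp_apply, comp_aeval]
  congr 2
  ext i
  simp [Matrix.mulVec, dotProduct]

theorem gradAt_linSubst (M : Matrix (Fin m) (Fin n) k) (v : Fin n → R)
    (f : MvPolynomial (Fin m) k) :
    gradAt v (linSubst M f) =
      Matrix.vecMul (gradAt ((M.map (algebraMap k R)).mulVec v) f) (M.map (algebraMap k R)) := by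
  induction f using MvPolynomial.induction_on with
  | C a => ext i; simp [linSubst, Matrix.vecMul, dotProduct]
  | add p q hp hq => simp only [map_add, gradAt_add, hp, hq, Matrix.add_vecMul]
  | mul_X p i hp =>
    rw [map_mul, gradAt_mul, gradAt_mul, Matrix.add_vecMul, Matrix.smul_vecMul,
      Matrix.smul_vecMul, hp, aeval_linSubst, aeval_linSubst]
    congr 2
    ext j
    simp [linSubst, Matrix.vecMul, dotProduct, pderiv_X, Pi.single_apply, apply_ite]

theorem linSubst_isHomogeneous (M : Matrix (Fin m) (Fin n) k) {f : MvPolynomial (Fin m) k}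
    {d : ℕ} (hf : f.IsHomogeneous d) : (linSubst M f).IsHomogeneous d := by
  have := hf.aeval (fun i => ∑ j, C (M i j) * X j) (n := 1) (fun i =>
    IsHomogeneous.sum _ _ _ fun j _ => isHomogeneous_C_mul_X _ _)
  rwa [one_mul] at this

/-- The link between section and projection: restricting an equation to the hyperplanes `Mᵀ v`
projects its gradient by `M`. -/
theorem mulVec_gradAt_linSubst_transpose (M : Matrix (Fin m) (Fin n) k) (v : Fin m → k)
    (f : MvPolynomial (Fin n) k) :
    gradAt v (linSubst M.transpose f) = M.mulVec (gradAt (M.transpose.mulVec v) f) := by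
  rw [gradAt_linSubst]
  simp [Algebra.algebraMap_self, Matrix.vecMul_transpose]

end LinearSubstitution

/-! ### Affine cones, tangent spaces and tangent hyperplanes in coordinates. -/

namespace SpaceCurve

variable {n : ℕ}

theorem mem_idealOf {Z : Set (PSpace n)} {f : MvPolynomial (Fin n) ℂ} :
    f ∈ idealOf Z ↔ ∀ v ∈ cone Z, aeval v f = 0 := Iff.rfl

theorem smul_mem_cone {Z : Set (PSpace n)} {v : Fin n → ℂ} (hv : v ∈ cone Z) {c : ℂ}
    (hc : c ≠ 0) : c • v ∈ cone Z := by
  obtain ⟨h0, hv⟩ := hv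
  refine ⟨smul_ne_zero hc h0, ?_⟩
  rwa [(Projectivization.mk_eq_mk_iff' ℂ _ _ (smul_ne_zero hc h0) h0).mpr ⟨c, rfl⟩]

theorem rep_mem_cone {Z : Set (PSpace n)} {p : PSpace n} : p.rep ∈ cone Z ↔ p ∈ Z := by
  refine ⟨fun ⟨_, h⟩ => by rwa [Projectivization.mk_rep] at h, fun h => ⟨p.rep_nonzero, ?_⟩⟩
  rwa [Projectivization.mk_rep]

theorem homogeneousComponent_mem_idealOf {Z : Set (PSpace n)} {f : MvPolynomial (Fin n) ℂ}
    (hf : f ∈ idealOf Z) (d : ℕ) : homogeneousComponent d f ∈ idealOf Z := fun v hv =>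
  eval_homogeneousComponent_eq_zero f v (fun _ hc => hf _ (smul_mem_cone hv hc)) d

/-- The affine cone over the Zariski closure of `Z`, with its vertex. -/
def affineCone (Z : Set (PSpace n)) : Set (Fin n → ℂ) :=
  {v | ∀ f ∈ idealOf Z, aeval v f = 0}

theorem cone_subset_affineCone (Z : Set (PSpace n)) : cone Z ⊆ affineCone Z :=
  fun v hv _ hf => hf v hv

theorem smul_mem_affineCone {Z : Set (PSpace n)} {v : Fin n → ℂ} (hv : v ∈ affineCone Z)
    (c : ℂ) : c • v ∈ affineCone Z := by
  intro f hf
  have := aeval_mul_eq_sum f c v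
  rw [Finset.sum_eq_zero fun d _ => by
    rw [hv _ (homogeneousComponent_mem_idealOf hf d), mul_zero]] at this
  exact this

theorem exists_rep_eq_smul (v : Fin n → ℂ) (hv : v ≠ 0) :
    ∃ c : ℂ, c ≠ 0 ∧ (Projectivization.mk ℂ v hv).rep = c • v := by
  obtain ⟨a, ha⟩ := Projectivization.exists_smul_eq_mk_rep ℂ v hv
  exact ⟨a, a.ne_zero, ha.symm⟩

theorem mem_cone_of_mem_affineCone {X : Set (PSpace n)} (hX : zariskiClosure X = X)
    {v : Fin n → ℂ} (hv : v ∈ affineCone X) (h0 : v ≠ 0) : v ∈ cone X := by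
  refine ⟨h0, ?_⟩
  rw [← hX]
  intro F hF
  obtain ⟨c, hc, hrep⟩ := exists_rep_eq_smul v h0
  change aeval _ F = 0
  rw [hrep]
  exact smul_mem_affineCone hv c F hF

/-- The vectors orthogonal to all gradients at `v` of equations of `Z`. -/
def tangentAt (Z : Set (PSpace n)) (v : Fin n → ℂ) : Submodule ℂ (Fin n → ℂ) where
  carrier := {w | ∀ f ∈ idealOf Z, gradAt v f ⬝ᵥ w = 0}
  zero_mem' := fun f _ => by simp
  add_mem' := fun ha hb f hf => by rw [dotProduct_add, ha f hf, hb f hf, add_zero]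
  smul_mem' := fun c a ha f hf => by rw [dotProduct_smul, ha f hf, smul_zero]

theorem tangentSpace_eq (Z : Set (PSpace n)) (p : PSpace n) :
    tangentSpace Z p = tangentAt Z p.rep := rfl

/-- The homogeneous components of an equation are again equations, and the gradient of each scales
by a power of `c`. -/
theorem tangentAt_smul (Z : Set (PSpace n)) (v : Fin n → ℂ) {c : ℂ} (hc : c ≠ 0) :
    tangentAt Z (c • v) = tangentAt Z v := by
  have key : ∀ (v : Fin n → ℂ) (c : ℂ), tangentAt Z v ≤ tangentAt Z (c • v) := by
    intro v c w hw f hf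
    rw [gradAt_eq_sum_homogeneousComponent, sum_dotProduct]
    refine Finset.sum_eq_zero fun d _ => ?_
    rcases d with _ | d
    · rw [gradAt_homogeneousComponent_zero, zero_dotProduct]
    · have := gradAt_mul_of_isHomogeneous (homogeneousComponent_isHomogeneous (d + 1) f) c v
      change gradAt (fun i => c * v i) _ ⬝ᵥ w = 0
      rw [this, smul_dotProduct, hw _ (homogeneousComponent_mem_idealOf hf _), smul_zero]
  refine le_antisymm ?_ (key v c)
  have := key (c • v) c⁻¹
  rwa [inv_smul_smul₀ hc] at this

theorem self_mem_tangentAt {Z : Set (PSpace n)} {v : Fin n → ℂ} (hv : v ∈ affineCone Z) :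
    v ∈ tangentAt Z v := by
  intro f hf
  rw [gradAt_eq_sum_homogeneousComponent, sum_dotProduct]
  refine Finset.sum_eq_zero fun d _ => ?_
  rw [dotProduct_gradAt_of_isHomogeneous (homogeneousComponent_isHomogeneous d f),
    hv _ (homogeneousComponent_mem_idealOf hf d), mul_zero]

/-- Frees the definition from the chosen representatives `rep`, using that tangent spaces are
invariant under scaling. -/
theorem mem_cone_tangentHyperplanes {X : Set (PSpace n)} {h : Fin n → ℂ} :
    h ∈ cone (tangentHyperplanes X) ↔ h ≠ 0 ∧ ∃ v ∈ cone X,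
      (Module.finrank ℂ (tangentAt X v) : WithBot ℕ∞) = ringKrullDim (CoordRing X) ∧
      ∀ w ∈ tangentAt X v, h ⬝ᵥ w = 0 := by
  constructor
  · rintro ⟨h0, p, ⟨hp, hdim⟩, hw⟩
    refine ⟨h0, p.rep, rep_mem_cone.mpr hp, hdim, fun w hwt => ?_⟩
    obtain ⟨c, hc, hrep⟩ := exists_rep_eq_smul h h0
    have := hw w hwt
    rw [hrep] at this
    change (c • h) ⬝ᵥ w = 0 at this
    rw [smul_dotProduct] at this
    exact (smul_eq_zero.mp this).resolve_left hc
  · rintro ⟨h0, v, ⟨hv0, hv⟩, hdim, hw⟩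
    obtain ⟨c, hc, hrep⟩ := exists_rep_eq_smul v hv0
    have ht : tangentSpace X (Projectivization.mk ℂ v hv0) = tangentAt X v := by
      rw [tangentSpace_eq, hrep, tangentAt_smul X v hc]
    refine ⟨h0, Projectivization.mk ℂ v hv0, ⟨hv, by rw [ht]; exact hdim⟩, fun w hwt => ?_⟩
    rw [ht] at hwt
    obtain ⟨c', _, hrep'⟩ := exists_rep_eq_smul h h0
    rw [hrep']
    change (c' • h) ⬝ᵥ w = 0
    rw [smul_dotProduct, hw w hwt, smul_zero]

/-- A hyperplane containing the tangent space is given by the gradient of an equation. -/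
theorem exists_gradAt_eq_of_orthogonal_tangentAt {Z : Set (PSpace n)} {v h : Fin n → ℂ}
    (hh : ∀ w ∈ tangentAt Z v, h ⬝ᵥ w = 0) : ∃ f ∈ idealOf Z, gradAt v f = h := by
  let g : MvPolynomial (Fin n) ℂ →ₗ[ℂ] (Fin n → ℂ) :=
    { toFun := gradAt v
      map_add' := gradAt_add v
      map_smul' := fun c f => by ext i; simp }
  have := mem_of_forall_dotProduct_eq_zero (((idealOf Z).restrictScalars ℂ).map g) h
    fun w hw => hh w fun f hf => hw _ ⟨f, hf, rfl⟩
  obtain ⟨f, hf, hfh⟩ := this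
  exact ⟨f, hf, hfh⟩

/-! ### Degrees of hypersurfaces with principal ideal. -/

section PrincipalIdeal

variable {S : Set (PSpace n)} {F : MvPolynomial (Fin n) ℂ}

/-- A nonzero component of `F` lies in the ideal, so `F` divides it; comparing degrees, the quotient
is a constant. -/
theorem isHomogeneous_of_idealOf_eq_span (hS : idealOf S = Ideal.span {F}) (hF : F ≠ 0) :
    F.IsHomogeneous F.totalDegree := by
  have hmem : F ∈ idealOf S := by rw [hS]; exact Ideal.mem_span_singleton_self F
  obtain ⟨d, hd⟩ : ∃ d, homogeneousComponent d F ≠ 0 := by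
    by_contra! hcon
    refine hF ?_
    rw [← sum_homogeneousComponent F]
    exact Finset.sum_eq_zero fun d _ => hcon d
  have hdvd := homogeneousComponent_mem_idealOf hmem d
  rw [hS, Ideal.mem_span_singleton] at hdvd
  obtain ⟨u, hu⟩ := hdvd
  have hu0 : u ≠ 0 := fun h => hd (by rw [hu, h, mul_zero])
  have hhom := homogeneousComponent_isHomogeneous d F
  have hdeg := totalDegree_mul_of_isDomain hF hu0
  have hle : d ≤ F.totalDegree := by
    by_contra hlt
    exact hd (homogeneousComponent_eq_zero d F (not_le.mp hlt))
  rw [← hu, hhom.totalDegree hd] at hdeg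
  have hud : u.totalDegree = 0 := by omega
  rw [totalDegree_eq_zero_iff_eq_C] at hud
  have hc : coeff 0 u ≠ 0 := fun h => hu0 (by rw [hud, h, map_zero])
  have hdF : d = F.totalDegree := by
    rw [hdeg, hud, totalDegree_C, add_zero]
  have hFu : F = homogeneousComponent d F * C (coeff 0 u)⁻¹ := by
    rw [hu]
    conv_rhs => rw [hud]
    rw [mul_assoc, ← C_mul]
    simp [mul_inv_cancel₀ hc]
  rw [← hdF, hFu, mul_comm]
  exact hhom.C_mul _

theorem zariskiClosure_eq_zeroSet (hS : idealOf S = Ideal.span {F}) :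
    zariskiClosure S = zeroSet F := by
  ext p
  constructor
  · intro hp
    exact hp F (by rw [hS]; exact Ideal.mem_span_singleton_self F)
  · intro hp G hG
    rw [hS, Ideal.mem_span_singleton] at hG
    obtain ⟨u, rfl⟩ := hG
    have hp' : eval p.rep F = 0 := hp
    change eval p.rep (F * u) = 0
    rw [map_mul, hp', zero_mul]

theorem isDefiningPolynomial_of_idealOf_eq_span (hS : idealOf S = Ideal.span {F}) (hF : F ≠ 0) :
    IsDefiningPolynomial F (zariskiClosure S) :=
  ⟨hF, isHomogeneous_of_idealOf_eq_span hS hF, (zariskiClosure_eq_zeroSet hS).symm⟩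

/-- A defining polynomial vanishes on `S`, so it is a nonzero multiple of the generator `F`. -/
theorem totalDegree_le_of_isDefiningPolynomial (hS : idealOf S = Ideal.span {F})
    {G : MvPolynomial (Fin n) ℂ} (hG : IsDefiningPolynomial G (zariskiClosure S)) :
    F.totalDegree ≤ G.totalDegree := by
  have hmem : G ∈ idealOf S := by
    rintro v ⟨hv0, hv⟩
    have h1 : Projectivization.mk ℂ v hv0 ∈ zariskiClosure S :=
      fun H hH => hH _ (rep_mem_cone.mpr hv)
    rw [← hG.zeroSet_eq] at h1
    obtain ⟨c, hc, hrep⟩ := exists_rep_eq_smul v hv0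
    have h2 : aeval (fun i => c * v i) G = 0 := by
      have : eval (Projectivization.mk ℂ v hv0).rep G = 0 := h1
      rwa [hrep] at this
    rw [hG.homogeneous.aeval_mul] at h2
    exact (mul_eq_zero.mp h2).resolve_left (pow_ne_zero _ hc)
  rw [hS, Ideal.mem_span_singleton] at hmem
  obtain ⟨u, rfl⟩ := hmem
  have h0 := hG.ne_zero
  rw [totalDegree_mul_of_isDomain (left_ne_zero_of_mul h0) (right_ne_zero_of_mul h0)]
  omega

theorem hypersurfaceDegree_eq (hS : idealOf S = Ideal.span {F}) (hF : F ≠ 0) :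
    hypersurfaceDegree (zariskiClosure S) = F.totalDegree := by
  refine le_antisymm (Nat.sInf_le ⟨F, isDefiningPolynomial_of_idealOf_eq_span hS hF, rfl⟩) ?_
  refine le_csInf ⟨_, F, isDefiningPolynomial_of_idealOf_eq_span hS hF, rfl⟩ ?_
  rintro _ ⟨G, hG, rfl⟩
  exact totalDegree_le_of_isDefiningPolynomial hS hG

theorem totalDegree_eq_of_isMinimalDefiningPolynomial (hS : idealOf S = Ideal.span {F})
    (hF : F ≠ 0) {G : MvPolynomial (Fin n) ℂ}
    (hG : IsMinimalDefiningPolynomial G (zariskiClosure S)) : G.totalDegree = F.totalDegree :=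
  le_antisymm (hG.minimal F (isDefiningPolynomial_of_idealOf_eq_span hS hF))
    (totalDegree_le_of_isDefiningPolynomial hS hG.toIsDefiningPolynomial)

end PrincipalIdeal

end SpaceCurve

/-! ### Independence of two vectors by minors. -/

section Pairs

variable {L : Type*} [Field L] {n : ℕ}

/-- Minors turn independence into the nonvanishing of a polynomial, which passes between the generic
point and closed points. -/
theorem linearIndependent_pair_of_minor_ne_zero {u v : Fin n → L} {a b : Fin n}
    (h : u a * v b - u b * v a ≠ 0) : LinearIndependent L ![u, v] := by
  rw [LinearIndependent.pair_iff]
  intro s t hst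
  have ha := congrFun hst a
  have hb := congrFun hst b
  simp only [Pi.add_apply, Pi.smul_apply, smul_eq_mul, Pi.zero_apply] at ha hb
  constructor
  · refine (mul_eq_zero.mp (?_ : s * (u a * v b - u b * v a) = 0)).resolve_right h
    linear_combination v b * ha - v a * hb
  · refine (mul_eq_zero.mp (?_ : t * (u a * v b - u b * v a) = 0)).resolve_right h
    linear_combination u a * hb - u b * ha

theorem exists_minor_ne_zero {u v : Fin n → L} (h : LinearIndependent L ![u, v]) :
    ∃ a b, u a * v b - u b * v a ≠ 0 := by
  by_contra! hcon
  obtain ⟨a, ha⟩ : ∃ a, u a ≠ 0 := Function.ne_iff.mp (h.ne_zero 0)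
  rw [LinearIndependent.pair_iff] at h
  refine ha (neg_eq_zero.mp (h (v a) (-u a) ?_).2)
  ext b
  simp only [Pi.add_apply, Pi.smul_apply, smul_eq_mul, Pi.zero_apply]
  linear_combination -hcon a b

end Pairs

/-! ### Generic points and their tangent vectors. -/

section GenericPoint

/-- A generic point of a prime ideal with coordinates in its residue field. -/
theorem Ideal.IsPrime.exists_genericPoint {k : Type} [Field k] {n : ℕ}
    {I : Ideal (MvPolynomial (Fin n) k)} (hI : I.IsPrime) :
    ∃ (K : Type) (_ : Field K) (_ : Algebra k K) (x : Fin n → K),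
      (∀ f, f ∈ I ↔ aeval x f = 0) ∧
      ∀ u : K, ∃ a b : MvPolynomial (Fin n) k,
        aeval x b ≠ 0 ∧ aeval x b * u = aeval x a := by
  let A := MvPolynomial (Fin n) k ⧸ I
  let K := FractionRing A
  let x : Fin n → K := fun i => algebraMap A K (Ideal.Quotient.mk I (X i))
  have hx : ∀ f, aeval x f = algebraMap A K (Ideal.Quotient.mk I f) := by
    intro f
    have : aeval x = ((IsScalarTower.toAlgHom k A K).comp (Ideal.Quotient.mkₐ k I)) := by
      ext i
      simp only [aeval_X, AlgHom.comp_apply]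
      rfl
    rw [this]; rfl
  have hx0 : ∀ f, f ∈ I ↔ aeval x f = 0 := by
    intro f
    rw [hx, map_eq_zero_iff _ (IsFractionRing.injective A K), Ideal.Quotient.eq_zero_iff_mem]
  refine ⟨K, inferInstance, inferInstance, x, hx0, fun u => ?_⟩
  obtain ⟨a, b, hb, rfl⟩ := IsFractionRing.div_surjective (A := A) u
  obtain ⟨a, rfl⟩ := Ideal.Quotient.mk_surjective a
  obtain ⟨b, rfl⟩ := Ideal.Quotient.mk_surjective b
  have hb0 : aeval x b ≠ 0 := by
    rw [hx, Ne, map_eq_zero_iff _ (IsFractionRing.injective A K)]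
    exact nonZeroDivisors.ne_zero hb
  refine ⟨a, b, hb0, ?_⟩
  rw [← hx, ← hx, mul_div_cancel₀ _ hb0]

theorem exists_common_denominator {k K : Type*} [Field k] [Field K] [Algebra k K] {n m : ℕ}
    {x : Fin n → K} (hx : ∀ u : K, ∃ a b : MvPolynomial (Fin n) k,
      aeval x b ≠ 0 ∧ aeval x b * u = aeval x a) (w : Fin m → K) :
    ∃ (b : MvPolynomial (Fin n) k) (a : Fin m → MvPolynomial (Fin n) k),
      aeval x b ≠ 0 ∧ ∀ i, aeval x (a i) = aeval x b * w i := by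
  choose a b hb hab using fun i => hx (w i)
  refine ⟨∏ i, b i, fun i => a i * ∏ j ∈ Finset.univ.erase i, b j, ?_, fun i => ?_⟩
  · rw [map_prod]
    exact Finset.prod_ne_zero_iff.mpr fun i _ => hb i
  · rw [map_mul, ← hab, ← Finset.mul_prod_erase Finset.univ b (Finset.mem_univ i), map_mul]
    ring

theorem finrank_le_ringKrullDim_quotient {k L : Type} [Field k] [CharZero k] [Field L]
    [Algebra k L] {n : ℕ} (v : Fin n → L) (J : Ideal (MvPolynomial (Fin n) k))
    (hJ : ∀ f, f ∈ J ↔ aeval v f = 0) (T : Submodule L (Fin n → L))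
    (hT : ∀ w ∈ T, ∀ f ∈ J, gradAt v f ⬝ᵥ w = 0) :
    (Module.finrank L T : WithBot ℕ∞) ≤ ringKrullDim (MvPolynomial (Fin n) k ⧸ J) := by
  let b := Module.finBasis L T
  refine LinearIndependent.natCast_le_ringKrullDim_quotient v J hJ (fun a => (b a : Fin n → L))
    (b.linearIndependent.map' T.subtype (Submodule.ker_subtype T)) fun a f hf => ?_
  exact hT _ (b a).2 f ((hJ f).mpr hf)

/-- If every derivation moved `x` only along itself, it would kill the ratios of coordinates. These
would be complex numbers, and the quotient ring, generated by one element, would have dimension at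
most 1. -/
theorem exists_derivation_linearIndependent {K : Type} [Field K] [Algebra ℂ K] {n : ℕ}
    {I : Ideal (MvPolynomial (Fin n) ℂ)} {x : Fin n → K} (hx : ∀ f, f ∈ I ↔ aeval x f = 0)
    (hdim : 1 < ringKrullDim (MvPolynomial (Fin n) ℂ ⧸ I)) :
    ∃ D : Derivation ℂ K K, LinearIndependent K ![x, fun i => D (x i)] := by
  by_contra! hcon
  obtain ⟨y, c, hc⟩ : ∃ (y : MvPolynomial (Fin n) ℂ) (c : Fin n → ℂ),
      ∀ i, aeval x (X i - C (c i) * y) = 0 := by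
    by_cases h0 : ∀ i, x i = 0
    · exact ⟨0, 0, fun i => by simp [h0]⟩
    · push Not at h0
      obtain ⟨i₀, hi₀⟩ := h0
      have : ∀ i, ∃ c : ℂ, algebraMap ℂ K c = x i / x i₀ := by
        intro i
        refine mem_range_algebraMap_of_derivation_eq_zero _ fun D => ?_
        have hminor : x i₀ * D (x i) - x i * D (x i₀) = 0 := by
          by_contra h
          exact hcon D (linearIndependent_pair_of_minor_ne_zero
            (u := x) (v := fun i => D (x i)) (a := i₀) (b := i) h)
        rw [Derivation.leibniz_div]
        simp only [smul_eq_mul]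
        rw [hminor, mul_zero]
      choose c hc using this
      refine ⟨X i₀, c, fun i => ?_⟩
      simp [hc, div_mul_cancel₀ _ hi₀]
  let φ : Polynomial ℂ →ₐ[ℂ] (MvPolynomial (Fin n) ℂ ⧸ I) :=
    Polynomial.aeval (Ideal.Quotient.mk I y)
  have hφ : Function.Surjective φ := by
    rw [← AlgHom.range_eq_top, eq_top_iff]
    have hX : ∀ i, Ideal.Quotient.mkₐ ℂ I (X i) ∈ φ.range := by
      intro i
      have h1 := hc i
      rw [← hx, ← Ideal.Quotient.eq_zero_iff_mem, map_sub, sub_eq_zero] at h1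
      refine ⟨Polynomial.C (c i) * Polynomial.X, ?_⟩
      change φ _ = Ideal.Quotient.mk I (X i)
      rw [h1, map_mul, map_mul]
      simp only [φ, Polynomial.aeval_X, Polynomial.aeval_C]
      rfl
    rintro a -
    obtain ⟨f, rfl⟩ := Ideal.Quotient.mkₐ_surjective ℂ I a
    induction f using MvPolynomial.induction_on with
    | C c => exact φ.range.algebraMap_mem c
    | add p q hp hq => rw [map_add]; exact add_mem hp hq
    | mul_X p i hp => rw [map_mul]; exact mul_mem hp (hX i)
  have h1 := ringKrullDim_le_of_surjective φ.toRingHom hφ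
  rw [Polynomial.ringKrullDim_of_isNoetherianRing, ringKrullDim_eq_zero_of_field, zero_add] at h1
  exact absurd hdim (not_lt.mpr h1)

end GenericPoint

/-! ### Polynomial tangent and conormal frames. -/

namespace SpaceCurve

/-- Polynomial vector fields describing the tangent and conormal spaces of a curve at its general
points. -/
structure TangentFrame (X : Set (PSpace 4)) where
  τ : Fin 4 → MvPolynomial (Fin 4) ℂ
  deg : ℕ
  f₁ : MvPolynomial (Fin 4) ℂ
  f₂ : MvPolynomial (Fin 4) ℂ
  g : MvPolynomial (Fin 4) ℂ
  degG : ℕ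
  isHomogeneous_τ : ∀ i, (τ i).IsHomogeneous (deg + 1)
  isHomogeneous_g : g.IsHomogeneous (degG + 1)
  f₁_mem : f₁ ∈ idealOf X
  f₂_mem : f₂ ∈ idealOf X
  g_notMem : g ∉ idealOf X
  tangent : ∀ f ∈ idealOf X, ∑ i, pderiv i f * τ i ∈ idealOf X
  linearIndependent_τ : ∀ {L : Type} [Field L] [Algebra ℂ L] (p : Fin 4 → L),
    aeval p g ≠ 0 → LinearIndependent L ![p, fun i => aeval p (τ i)]
  linearIndependent_grad : ∀ {L : Type} [Field L] [Algebra ℂ L] (p : Fin 4 → L),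
    aeval p g ≠ 0 → LinearIndependent L ![gradAt p f₁, gradAt p f₂]

theorem sum_range_homogeneousComponent {σ : Type*} (p : MvPolynomial σ ℂ) {N : ℕ}
    (hN : p.totalDegree < N) : ∑ d ∈ Finset.range N, homogeneousComponent d p = p := by
  conv_rhs => rw [← sum_homogeneousComponent p]
  refine (Finset.sum_subset (Finset.range_mono hN) fun d _ hd => ?_).symm
  exact homogeneousComponent_eq_zero _ _ (by simpa using hd)

/-- Homogeneous components of a tangent vector field are tangent. -/
theorem sum_pderiv_mul_homogeneousComponent_mem {n : ℕ} {X : Set (PSpace n)}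
    {t : Fin n → MvPolynomial (Fin n) ℂ}
    (ht : ∀ f ∈ idealOf X, ∑ i, pderiv i f * t i ∈ idealOf X) (d : ℕ) :
    ∀ f ∈ idealOf X, ∑ i, pderiv i f * homogeneousComponent d (t i) ∈ idealOf X := by
  intro f hf v hv
  -- The gradient of `f` is frozen at `v`. As tangent spaces are constant along the ray of `v`, `Q`
  -- vanishes on that punctured line, and so do its components.
  let Q : MvPolynomial (Fin n) ℂ := ∑ i, C (gradAt v f i) * t i
  have hQ : ∀ c : ℂ, c ≠ 0 → aeval (fun i => c * v i) Q = 0 := by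
    intro c hc
    have hmem : (fun i => aeval (c • v) (t i)) ∈ tangentAt X (c • v) := by
      intro f' hf'
      have := ht f' hf' _ (smul_mem_cone hv hc)
      simpa [dotProduct] using this
    rw [tangentAt_smul X v hc] at hmem
    have := hmem f hf
    simp only [Q, map_sum, map_mul, aeval_C, Algebra.algebraMap_self, RingHom.id_apply]
    exact this
  have := eval_homogeneousComponent_eq_zero Q v hQ d
  simpa [Q, homogeneousComponent_C_mul] using this

/-- Clear denominators in a derivation at the generic point that is not proportional to `x`, then
keep a homogeneous component whose minor with `x` survives. -/
theorem exists_homogeneous_tangentField {n : ℕ} {X : Set (PSpace n)} {K : Type} [Field K]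
    [Algebra ℂ K] {x : Fin n → K} (hx : ∀ f, f ∈ idealOf X ↔ aeval x f = 0)
    (hfrac : ∀ u : K, ∃ a b : MvPolynomial (Fin n) ℂ, aeval x b ≠ 0 ∧ aeval x b * u = aeval x a)
    (hdim : 1 < ringKrullDim (CoordRing X)) :
    ∃ (τ : Fin n → MvPolynomial (Fin n) ℂ) (d : ℕ) (a b : Fin n),
      (∀ i, (τ i).IsHomogeneous (d + 1)) ∧
      MvPolynomial.X a * τ b - MvPolynomial.X b * τ a ∉ idealOf X ∧
      ∀ f ∈ idealOf X, ∑ i, pderiv i f * τ i ∈ idealOf X := by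
  obtain ⟨D, hD⟩ := exists_derivation_linearIndependent hx hdim
  obtain ⟨b₀, t, hb₀, ht⟩ := exists_common_denominator hfrac fun i => D (x i)
  obtain ⟨a, b, hab⟩ := exists_minor_ne_zero hD
  obtain ⟨i₀, hi₀⟩ : ∃ i, x i ≠ 0 := Function.ne_iff.mp (hD.ne_zero 0)
  have htan : ∀ f ∈ idealOf X, ∑ i, pderiv i f * t i ∈ idealOf X := by
    intro f hf
    have h1 := D.apply_aeval_mvPolynomial x f
    rw [(hx f).mp hf, map_zero] at h1
    rw [hx, map_sum]
    calc _ = aeval x b₀ * ∑ i, aeval x (pderiv i f) * D (x i) := by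
          rw [Finset.mul_sum]
          exact Finset.sum_congr rfl fun i _ => by rw [map_mul, ht]; ring
      _ = 0 := by rw [← h1, mul_zero]
  have hmin : MvPolynomial.X a * t b - MvPolynomial.X b * t a ∉ idealOf X := by
    rw [hx, map_sub, map_mul, map_mul, aeval_X, aeval_X, ht, ht]
    intro h
    refine hab ((mul_eq_zero.mp (?_ : aeval x b₀ * _ = 0)).resolve_left hb₀)
    rw [← h]
    ring
  obtain ⟨d, hd⟩ : ∃ d, MvPolynomial.X a * homogeneousComponent d (t b) -
      MvPolynomial.X b * homogeneousComponent d (t a) ∉ idealOf X := by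
    by_contra! hcon
    refine hmin ?_
    let N := (t a).totalDegree + (t b).totalDegree + 1
    rw [← sum_range_homogeneousComponent (t a) (N := N) (by omega),
      ← sum_range_homogeneousComponent (t b) (N := N) (by omega), Finset.mul_sum, Finset.mul_sum,
      ← Finset.sum_sub_distrib]
    exact sum_mem fun d _ => hcon d
  have hprime : (idealOf X).IsPrime := by
    have : idealOf X = RingHom.ker (aeval x : MvPolynomial (Fin n) ℂ →ₐ[ℂ] K) := by
      ext f; rw [hx]; rfl
    rw [this]; exact RingHom.ker_isPrime _
  -- The factor `X i₀`, nonzero at `x`, makes the degree positive, so that rescaling a point can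
  -- rescale `τ` by any nonzero scalar.
  refine ⟨fun i => MvPolynomial.X i₀ * homogeneousComponent d (t i), d, a, b, fun i => ?_,
    fun h => ?_, fun f hf => ?_⟩
  · rw [add_comm]
    exact (isHomogeneous_X ℂ i₀).mul (homogeneousComponent_isHomogeneous d _)
  · have h' : MvPolynomial.X i₀ * (MvPolynomial.X a * homogeneousComponent d (t b) -
      MvPolynomial.X b * homogeneousComponent d (t a)) ∈ idealOf X := by
      convert h using 1
      ring
    rcases hprime.mem_or_mem h' with h' | h'
    · rw [hx, aeval_X] at h'
      exact hi₀ h'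
    · exact hd h'
  · have := (idealOf X).mul_mem_left (MvPolynomial.X i₀)
      (sum_pderiv_mul_homogeneousComponent_mem htan d f hf)
    rw [Finset.mul_sum] at this
    convert this using 1
    exact Finset.sum_congr rfl fun i _ => by ring

/-- If the gradients at `x` spanned less than a plane, their orthogonal space would consist of at
least 3 dimensions of tangent vectors, above the Krull dimension. -/
theorem exists_homogeneous_equations {X : Set (PSpace 4)} {K : Type} [Field K]
    [Algebra ℂ K] {x : Fin 4 → K} (hx : ∀ f, f ∈ idealOf X ↔ aeval x f = 0)
    (hdim : ringKrullDim (CoordRing X) ≤ 2) :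
    ∃ (f₁ f₂ : MvPolynomial (Fin 4) ℂ) (d₁ d₂ : ℕ), f₁ ∈ idealOf X ∧ f₂ ∈ idealOf X ∧
      f₁.IsHomogeneous d₁ ∧ f₂.IsHomogeneous d₂ ∧
      LinearIndependent K ![gradAt x f₁, gradAt x f₂] := by
  have hcomp : ∀ w : Fin 4 → K, (∀ f ∈ idealOf X, ∀ d, f.IsHomogeneous d → gradAt x f ⬝ᵥ w = 0) →
      ∀ f ∈ idealOf X, gradAt x f ⬝ᵥ w = 0 := by
    intro w hw f hf
    rw [gradAt_eq_sum_homogeneousComponent, sum_dotProduct]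
    exact Finset.sum_eq_zero fun d _ => hw _ (homogeneousComponent_mem_idealOf hf d) d
      (homogeneousComponent_isHomogeneous d f)
  have hbound : ∀ T : Submodule K (Fin 4 → K), (∀ w ∈ T, ∀ f ∈ idealOf X, ∀ d,
      f.IsHomogeneous d → gradAt x f ⬝ᵥ w = 0) → Module.finrank K T ≤ 2 := by
    intro T hT
    have := (finrank_le_ringKrullDim_quotient x (idealOf X) hx T
      fun w hw => hcomp w (hT w hw)).trans hdim
    exact_mod_cast this
  obtain ⟨f₁, hf₁, d₁, hd₁, h₁⟩ : ∃ f₁ ∈ idealOf X, ∃ d, f₁.IsHomogeneous d ∧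
      gradAt x f₁ ≠ 0 := by
    by_contra! hcon
    have := hbound ⊤ fun w _ f hf d hd => by rw [hcon f hf d hd, zero_dotProduct]
    rw [finrank_top, Module.finrank_fin_fun] at this
    omega
  by_contra! hcon
  let ℓ : (Fin 4 → K) →ₗ[K] K :=
    { toFun := fun w => gradAt x f₁ ⬝ᵥ w
      map_add' := dotProduct_add _
      map_smul' := fun c w => dotProduct_smul c _ w }
  have h1 := hbound (LinearMap.ker ℓ) fun w hw f hf d hd => by
    have hdep := hcon f₁ f d₁ d hf₁ hf hd₁ hd
    rw [LinearIndependent.pair_iff' h₁] at hdep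
    push Not at hdep
    obtain ⟨c, hc⟩ := hdep
    have hw' : gradAt x f₁ ⬝ᵥ w = 0 := hw
    rw [← hc, smul_dotProduct, hw', smul_zero]
  have h2 := LinearMap.finrank_range_add_finrank_ker ℓ
  have h3 := Submodule.finrank_le (LinearMap.range ℓ)
  rw [Module.finrank_fin_fun] at h2
  rw [Module.finrank_self] at h3
  omega

/-- `g` is a minor of `(x, τ)` times a minor of the two gradients, so `g ≠ 0` gives both
independences over any field, and `g ∉ idealOf X` by primality. -/
theorem IsIrreducibleCurve.nonempty_tangentFrame {X : Set (PSpace 4)}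
    (hX : IsIrreducibleCurve X) : Nonempty (TangentFrame X) := by
  obtain ⟨K, _, _, x, hx, hfrac⟩ := hX.irreducible.exists_genericPoint
  obtain ⟨τ, d, a, b, hτ, hab, htan⟩ := exists_homogeneous_tangentField hx hfrac (by
    rw [hX.dim_eq]; exact_mod_cast one_lt_two)
  obtain ⟨f₁, f₂, d₁, d₂, hf₁, hf₂, hd₁, hd₂, hf⟩ := exists_homogeneous_equations hx hX.dim_eq.le
  obtain ⟨i, j, hij⟩ := exists_minor_ne_zero hf
  refine ⟨{ τ := τ, deg := d, f₁ := f₁, f₂ := f₂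
            g := (MvPolynomial.X a * τ b - MvPolynomial.X b * τ a) *
              (pderiv i f₁ * pderiv j f₂ - pderiv j f₁ * pderiv i f₂)
            degG := d + 1 + ((d₁ - 1) + (d₂ - 1))
            isHomogeneous_τ := hτ
            isHomogeneous_g := ?_
            f₁_mem := hf₁, f₂_mem := hf₂
            g_notMem := ?_
            tangent := htan
            linearIndependent_τ := ?_
            linearIndependent_grad := ?_ }⟩
  · have h := (((isHomogeneous_X ℂ a).mul (hτ b)).sub ((isHomogeneous_X ℂ b).mul (hτ a))).mul
      ((hd₁.pderiv (i := i)).mul (hd₂.pderiv (i := j)) |>.sub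
        ((hd₁.pderiv (i := j)).mul (hd₂.pderiv (i := i))))
    rwa [show d + 1 + ((d₁ - 1) + (d₂ - 1)) + 1 = 1 + (d + 1) + ((d₁ - 1) + (d₂ - 1)) by omega]
  · intro h
    rcases hX.irreducible.mem_or_mem h with h | h
    · exact hab h
    · rw [hx] at h
      simp only [map_sub, map_mul] at h
      exact hij h
  · intro L _ _ p hp
    rw [map_mul] at hp
    have := left_ne_zero_of_mul hp
    simp only [map_sub, map_mul, aeval_X] at this
    exact linearIndependent_pair_of_minor_ne_zero (a := a) (b := b) this
  · intro L _ _ p hp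
    rw [map_mul] at hp
    have := right_ne_zero_of_mul hp
    simp only [map_sub, map_mul] at this
    exact linearIndependent_pair_of_minor_ne_zero (a := i) (b := j) this

end SpaceCurve

/-! ### Orthogonal planes in dimension four. -/

section Orthogonality

variable {L : Type*} [Field L]

theorem finrank_add_le_of_orthogonal {n r : ℕ} {u : Fin r → Fin n → L}
    (hu : LinearIndependent L u) (T : Submodule L (Fin n → L))
    (hT : ∀ w ∈ T, ∀ a, u a ⬝ᵥ w = 0) : Module.finrank L T + r ≤ n := by
  let ℓ := (Matrix.of u).mulVecLin
  have h1 : Module.finrank L (LinearMap.range ℓ) = r := by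
    have := LinearIndependent.rank_matrix (M := Matrix.of u) hu
    rw [Fintype.card_fin] at this
    exact this
  have h2 : T ≤ LinearMap.ker ℓ := fun w hw => by
    rw [LinearMap.mem_ker]
    ext a
    exact hT w hw a
  have h3 := LinearMap.finrank_range_add_finrank_ker ℓ
  have h4 := Submodule.finrank_mono h2
  rw [Module.finrank_fin_fun] at h3
  omega

/-- A third independent vector orthogonal to a plane would exceed dimension 4. It serves both to
find tangent vectors from conormal ones and conversely. -/
theorem exists_eq_add_of_orthogonal {s₁ s₂ u₁ u₂ h : Fin 4 → L}
    (hs : LinearIndependent L ![s₁, s₂]) (hu : LinearIndependent L ![u₁, u₂])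
    (h11 : u₁ ⬝ᵥ s₁ = 0) (h12 : u₁ ⬝ᵥ s₂ = 0) (h21 : u₂ ⬝ᵥ s₁ = 0) (h22 : u₂ ⬝ᵥ s₂ = 0)
    (h1 : h ⬝ᵥ s₁ = 0) (h2 : h ⬝ᵥ s₂ = 0) : ∃ c d : L, c • u₁ + d • u₂ = h := by
  by_contra hcon
  have hmem : h ∉ Submodule.span L (Set.range ![u₁, u₂]) := by
    rw [Matrix.range_cons, Matrix.range_cons, Matrix.range_empty, Set.union_empty,
      Set.singleton_union, Submodule.mem_span_pair]
    exact hcon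
  have hind : LinearIndependent L (Fin.cons h ![u₁, u₂] : Fin 3 → Fin 4 → L) :=
    linearIndependent_finCons.mpr ⟨hu, hmem⟩
  have := finrank_add_le_of_orthogonal hind (Submodule.span L (Set.range ![s₁, s₂])) (by
    intro w hw a
    induction hw using Submodule.span_induction with
    | mem w hw =>
      obtain ⟨b, rfl⟩ := hw
      fin_cases a <;> fin_cases b
      exacts [h1, h2, h11, h12, h21, h22]
    | zero => simp
    | add v w _ _ hv hw => rw [dotProduct_add, hv, hw, add_zero]
    | smul c v _ hv => rw [dotProduct_smul, hv, smul_zero])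
  rw [finrank_span_eq_card hs, Fintype.card_fin] at this
  omega

end Orthogonality

/-! ### Reduction to good points, and a criterion for lines. -/

namespace SpaceCurve

variable {X : Set (PSpace 4)}

/-- Density of a nonempty open subset of an irreducible set: `s * P` vanishes everywhere. -/
theorem mem_idealOf_of_forall_ne_zero {n : ℕ} {X : Set (PSpace n)} (hI : (idealOf X).IsPrime)
    {s P : MvPolynomial (Fin n) ℂ} (hs : s ∉ idealOf X)
    (h : ∀ p ∈ cone X, aeval p s ≠ 0 → aeval p P = 0) : P ∈ idealOf X := by
  refine (hI.mem_or_mem (x := s) fun p hp => ?_).resolve_left hs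
  rw [map_mul]
  by_cases hsp : aeval p s = 0
  · rw [hsp, zero_mul]
  · rw [h p hp hsp, mul_zero]

theorem exists_mem_cone_ne_zero {n : ℕ} {X : Set (PSpace n)} {s : MvPolynomial (Fin n) ℂ}
    (hs : s ∉ idealOf X) : ∃ p ∈ cone X, aeval p s ≠ 0 := by
  rw [mem_idealOf] at hs
  push Not at hs
  exact hs

theorem aeval_aeval {R : Type*} [CommRing R] [Algebra ℂ R] {m n : ℕ} (v : Fin n → R)
    (q : Fin m → MvPolynomial (Fin n) ℂ) (f : MvPolynomial (Fin m) ℂ) :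
    aeval v (aeval q f) = aeval (fun i => aeval v (q i)) f := by
  rw [← AlgHom.comp_apply, comp_aeval]

namespace TangentFrame

variable (fr : TangentFrame X)

/-- The tangent vector field evaluated at a point. -/
noncomputable def tau {R : Type*} [CommRing R] [Algebra ℂ R] (p : Fin 4 → R) : Fin 4 → R :=
  fun i => aeval p (fr.τ i)

theorem gradAt_dotProduct_tau {R : Type*} [CommRing R] [Algebra ℂ R] {p : Fin 4 → R}
    (hp : ∀ f ∈ idealOf X, aeval p f = 0) {f : MvPolynomial (Fin 4) ℂ} (hf : f ∈ idealOf X) :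
    gradAt p f ⬝ᵥ fr.tau p = 0 := by
  have := hp _ (fr.tangent f hf)
  simpa [dotProduct, tau] using this

theorem gradAt_dotProduct_self {R : Type*} [CommRing R] [Algebra ℂ R] {n : ℕ}
    {X : Set (PSpace n)} {p : Fin n → R}
    (hp : ∀ f ∈ idealOf X, aeval p f = 0) {f : MvPolynomial (Fin n) ℂ} (hf : f ∈ idealOf X) :
    gradAt p f ⬝ᵥ p = 0 := by
  rw [gradAt_eq_sum_homogeneousComponent, sum_dotProduct]
  refine Finset.sum_eq_zero fun d _ => ?_
  rw [dotProduct_gradAt_of_isHomogeneous (homogeneousComponent_isHomogeneous d f),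
    hp _ (homogeneousComponent_mem_idealOf hf d), mul_zero]

theorem tau_smul {R : Type*} [CommRing R] [Algebra ℂ R] (c : R) (p : Fin 4 → R) :
    fr.tau (c • p) = c ^ (fr.deg + 1) • fr.tau p := by
  ext i
  exact (fr.isHomogeneous_τ i).aeval_mul c p

section Field

variable {L : Type} [Field L] [Algebra ℂ L] {p : Fin 4 → L}
  (hp : ∀ f ∈ idealOf X, aeval p f = 0) (hg : aeval p fr.g ≠ 0)

include hp hg

theorem exists_eq_of_tangent {w : Fin 4 → L} (h₁ : gradAt p fr.f₁ ⬝ᵥ w = 0)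
    (h₂ : gradAt p fr.f₂ ⬝ᵥ w = 0) : ∃ a b : L, a • p + b • fr.tau p = w := by
  have h := exists_eq_add_of_orthogonal (h := w) (fr.linearIndependent_grad p hg)
    (fr.linearIndependent_τ p hg)
    (by rw [dotProduct_comm]; exact gradAt_dotProduct_self hp fr.f₁_mem)
    (by rw [dotProduct_comm]; exact gradAt_dotProduct_self hp fr.f₂_mem)
    (by rw [dotProduct_comm]; exact fr.gradAt_dotProduct_tau hp fr.f₁_mem)
    (by rw [dotProduct_comm]; exact fr.gradAt_dotProduct_tau hp fr.f₂_mem)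
    (by rw [dotProduct_comm]; exact h₁) (by rw [dotProduct_comm]; exact h₂)
  exact h

theorem exists_eq_of_conormal {h : Fin 4 → L} (h₁ : h ⬝ᵥ p = 0) (h₂ : h ⬝ᵥ fr.tau p = 0) :
    ∃ s t : L, s • gradAt p fr.f₁ + t • gradAt p fr.f₂ = h :=
  exists_eq_add_of_orthogonal (fr.linearIndependent_τ p hg) (fr.linearIndependent_grad p hg)
    (gradAt_dotProduct_self hp fr.f₁_mem) (fr.gradAt_dotProduct_tau hp fr.f₁_mem)
    (gradAt_dotProduct_self hp fr.f₂_mem) (fr.gradAt_dotProduct_tau hp fr.f₂_mem) h₁ h₂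

end Field

section Points

variable {p : Fin 4 → ℂ} (hp : p ∈ affineCone X) (hg : aeval p fr.g ≠ 0)

include hp hg

theorem tangentAt_eq_span : tangentAt X p = Submodule.span ℂ {p, fr.tau p} := by
  refine le_antisymm (fun w hw => ?_) ?_
  · rw [Submodule.mem_span_pair]
    exact fr.exists_eq_of_tangent hp hg (hw _ fr.f₁_mem) (hw _ fr.f₂_mem)
  · rw [Submodule.span_le]
    rintro w (rfl | rfl)
    · exact self_mem_tangentAt hp
    · exact fun f hf => fr.gradAt_dotProduct_tau hp hf

theorem finrank_tangentAt : Module.finrank ℂ (tangentAt X p) = 2 := by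
  have := finrank_span_eq_card (fr.linearIndependent_τ p hg)
  rw [Matrix.range_cons, Matrix.range_cons, Matrix.range_empty, Set.union_empty,
    Set.singleton_union] at this
  rw [fr.tangentAt_eq_span hp hg]
  exact this

omit hp in
theorem ne_zero_of_good : p ≠ 0 := (fr.linearIndependent_τ p hg).ne_zero 0

end Points

/-- A polynomial vanishing on the conormal spaces at the good points vanishes at all gradients of
equations of the curve. -/
theorem aeval_gradAt_eq_zero (hX : IsIrreducibleCurve X) {f φ : MvPolynomial (Fin 4) ℂ}
    (hf : ∀ p ∈ cone X, aeval p fr.g ≠ 0 → ∀ s t : ℂ,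
      aeval (s • gradAt p fr.f₁ + t • gradAt p fr.f₂) f = 0) (hφ : φ ∈ idealOf X)
    {v : Fin 4 → ℂ} (hv : v ∈ cone X) : aeval (gradAt v φ) f = 0 := by
  -- Composing `f` with the gradient of `φ` gives a polynomial in the point, so its vanishing
  -- spreads from the good points to all of `X`.
  have hmem : aeval (fun i => pderiv i φ) f ∈ idealOf X := by
    refine mem_idealOf_of_forall_ne_zero hX.irreducible fr.g_notMem fun p hp hg => ?_
    have hp' := cone_subset_affineCone X hp
    obtain ⟨s, t, hst⟩ := fr.exists_eq_of_conormal (h := gradAt p φ) hp' hg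
      (gradAt_dotProduct_self hp' hφ) (fr.gradAt_dotProduct_tau hp' hφ)
    rw [aeval_aeval]
    change aeval (gradAt p φ) f = 0
    rw [← hst]
    exact hf p hp hg s t
  have := hmem v hv
  rwa [aeval_aeval] at this

/-- Good points are smooth, with conormal space spanned by the two gradients. Conversely, a tangent
hyperplane at any smooth point is the gradient of an equation, which `aeval_gradAt_eq_zero` covers.
-/
theorem mem_idealOf_tangentHyperplanes (hX : IsIrreducibleCurve X) (f : MvPolynomial (Fin 4) ℂ) :
    f ∈ idealOf (tangentHyperplanes X) ↔ ∀ p ∈ cone X, aeval p fr.g ≠ 0 → ∀ s t : ℂ,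
      aeval (s • gradAt p fr.f₁ + t • gradAt p fr.f₂) f = 0 := by
  constructor
  · intro hf p hp hg
    have hp' := cone_subset_affineCone X hp
    have hcone : ∀ s t : ℂ, s • gradAt p fr.f₁ + t • gradAt p fr.f₂ ≠ 0 →
        s • gradAt p fr.f₁ + t • gradAt p fr.f₂ ∈ cone (tangentHyperplanes X) := by
      intro s t h0
      refine mem_cone_tangentHyperplanes.mpr ⟨h0, p, hp, ?_, fun w hw => ?_⟩
      · rw [fr.finrank_tangentAt hp' hg, hX.dim_eq]; rfl
      · rw [add_dotProduct, smul_dotProduct, smul_dotProduct, hw _ fr.f₁_mem, hw _ fr.f₂_mem]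
        simp
    intro s t
    -- The zero vector represents no hyperplane; `f` vanishes there because its components vanish on
    -- a nonzero conormal vector.
    by_cases h0 : s • gradAt p fr.f₁ + t • gradAt p fr.f₂ = 0
    · have h1 := hcone 1 0 (by
        simpa using (fr.linearIndependent_grad p hg).ne_zero 0)
      have := smul_mem_affineCone (cone_subset_affineCone _ h1) 0 f hf
      rw [zero_smul] at this
      rw [h0, this]
    · exact hf _ (hcone s t h0)
  · intro hf h hh
    obtain ⟨_, v, hv, _, horth⟩ := mem_cone_tangentHyperplanes.mp hh
    obtain ⟨φ, hφ, rfl⟩ := exists_gradAt_eq_of_orthogonal_tangentAt horth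
    exact fr.aeval_gradAt_eq_zero hX hf hφ hv

end TangentFrame

/-- An irreducible curve on which all coordinates are combinations of two of them is a line. -/
theorem IsIrreducibleCurve.isLine_of_linear (hX : IsIrreducibleCurve X) (fr : TangentFrame X)
    (i j : Fin 4) (c c' : Fin 4 → ℂ)
    (h : ∀ k, (MvPolynomial.X k - (C (c k) * MvPolynomial.X j - C (c' k) * MvPolynomial.X i) :
      MvPolynomial (Fin 4) ℂ) ∈ idealOf X) : IsLine X := by
  let ρ : (Fin 2 → ℂ) →ₗ[ℂ] (Fin 4 → ℂ) :=
    { toFun := fun u k => c k * u 1 - c' k * u 0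
      map_add' := fun u v => by ext k; simp only [Pi.add_apply]; ring
      map_smul' := fun a u => by
        ext k; simp only [Pi.smul_apply, smul_eq_mul, RingHom.id_apply]; ring }
  have hmem : ∀ v ∈ affineCone X, v ∈ LinearMap.range ρ := by
    intro v hv
    refine ⟨![v i, v j], ?_⟩
    ext k
    have := hv _ (h k)
    simp only [map_sub, map_mul, aeval_X, aeval_C, Algebra.algebraMap_self, RingHom.id_apply] at this
    change c k * v j - c' k * v i = v k
    linear_combination -this
  have hmem_tau : ∀ v ∈ affineCone X, fr.tau v ∈ LinearMap.range ρ := by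
    intro v hv
    refine ⟨![fr.tau v i, fr.tau v j], ?_⟩
    ext k
    have := fr.gradAt_dotProduct_tau hv (h k)
    simp only [dotProduct, gradAt_apply, map_sub, Derivation.leibniz, pderiv_X, pderiv_C,
      smul_eq_mul, mul_zero, add_zero, map_mul, aeval_C, Algebra.algebraMap_self,
      RingHom.id_apply, sub_mul, Finset.sum_sub_distrib] at this
    simp only [Pi.single_apply, apply_ite (aeval v), map_one, map_zero, mul_ite, ite_mul, mul_one,
      mul_zero, one_mul, zero_mul, Finset.sum_ite_eq, Finset.mem_univ, if_true] at this
    change c k * fr.tau v j - c' k * fr.tau v i = fr.tau v k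
    linear_combination -this
  refine ⟨LinearMap.range ρ, le_antisymm ?_ ?_, ?_⟩
  · have := LinearMap.finrank_range_le ρ
    rwa [Module.finrank_fin_fun] at this
  · obtain ⟨p, hp, hg⟩ := exists_mem_cone_ne_zero fr.g_notMem
    have hp' := cone_subset_affineCone X hp
    refine (fr.finrank_tangentAt hp' hg).ge.trans (Submodule.finrank_mono ?_)
    rw [fr.tangentAt_eq_span hp' hg, Submodule.span_le]
    rintro w (rfl | rfl)
    · exact hmem _ hp'
    · exact hmem_tau _ hp'
  · ext p
    constructor
    · intro hp
      exact hmem _ (cone_subset_affineCone X (rep_mem_cone.mpr hp))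
    · rintro ⟨u, hu⟩
      rw [← rep_mem_cone]
      refine mem_cone_of_mem_affineCone hX.closed (fun f hf => ?_) p.rep_nonzero
      -- The coordinate ring is a quotient of a polynomial ring in two variables. An equation of `X`
      -- not vanishing on the plane would give this quotient map a kernel and push the dimension
      -- below 2.
      let φ : MvPolynomial (Fin 2) ℂ →ₐ[ℂ] CoordRing X :=
        aeval ![Ideal.Quotient.mk _ (MvPolynomial.X i), Ideal.Quotient.mk _ (MvPolynomial.X j)]
      let l : Fin 4 → MvPolynomial (Fin 2) ℂ :=
        fun k => C (c k) * MvPolynomial.X 1 - C (c' k) * MvPolynomial.X 0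
      have hφ : ∀ q, φ (aeval l q) = Ideal.Quotient.mk _ q := by
        intro q
        have : φ.comp (aeval l) = Ideal.Quotient.mkₐ ℂ (idealOf X) := by
          ext k
          have := Ideal.Quotient.eq.mpr (h k)
          simp only [AlgHom.comp_apply, aeval_X, Ideal.Quotient.mkₐ_eq_mk]
          rw [this]
          simp only [l, φ, map_sub, map_mul, aeval_X, aeval_C]
          rfl
        exact DFunLike.congr_fun this q
      have hsurj : Function.Surjective φ := by
        intro a
        obtain ⟨q, rfl⟩ := Ideal.Quotient.mk_surjective a
        exact ⟨_, hφ q⟩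
      by_cases h0 : aeval l f = 0
      · rw [← hu]
        have := congrArg (aeval u) h0
        rw [aeval_aeval, map_zero] at this
        rw [← this]
        congr 2
        ext k
        simp [l, ρ]
      · exfalso
        have h1 := ringKrullDim_succ_le_of_surjective φ.toRingHom hsurj
          (mem_nonZeroDivisors_of_ne_zero h0) (by
            change φ _ = 0
            rw [hφ, Ideal.Quotient.eq_zero_iff_mem]; exact hf)
        rw [MvPolynomial.ringKrullDim_of_isNoetherianRing, ringKrullDim_eq_zero_of_field,
          hX.dim_eq, zero_add, Nat.card_fin] at h1
        have h2 : ((2 + 1 : ℕ) : WithBot ℕ∞) ≤ (2 : ℕ) := by exact_mod_cast h1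
        rw [Nat.cast_le] at h2
        omega

end SpaceCurve

/-! ### Derivatives of forms, and primes of codimension one. -/

section Auxiliary

theorem Derivation.apply_dotProduct {k L : Type*} [Field k] [Field L] [Algebra k L] {n : ℕ}
    (D : Derivation k L L) (u v : Fin n → L) :
    D (u ⬝ᵥ v) = (fun i => D (u i)) ⬝ᵥ v + u ⬝ᵥ fun i => D (v i) := by
  simp only [dotProduct, map_sum, Derivation.leibniz, smul_eq_mul, Finset.sum_add_distrib]
  rw [add_comm]
  congr 1
  exact Finset.sum_congr rfl fun i _ => mul_comm _ _

theorem MvPolynomial.exists_pderiv_ne_zero {k : Type*} [Field k] [CharZero k] {n : ℕ}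
    {F : MvPolynomial (Fin n) k} (hF : F.IsHomogeneous F.totalDegree) (h : 0 < F.totalDegree) :
    ∃ i, pderiv i F ≠ 0 := by
  by_contra! hcon
  have := hF.sum_X_mul_pderiv
  simp only [hcon, mul_zero, Finset.sum_const_zero] at this
  have h0 : F ≠ 0 := by rintro rfl; simp at h
  rw [eq_comm, nsmul_eq_mul, mul_eq_zero, or_iff_left h0] at this
  exact h.ne' (by exact_mod_cast this)

theorem MvPolynomial.not_dvd_pderiv {k : Type*} [Field k] {n : ℕ}
    {F : MvPolynomial (Fin n) k} (hF : F.IsHomogeneous F.totalDegree) (h : 0 < F.totalDegree)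
    {i : Fin n} (hi : pderiv i F ≠ 0) : ¬ F ∣ pderiv i F := by
  rintro ⟨u, hu⟩
  have h1 := (hF.pderiv (i := i)).totalDegree hi
  rw [hu] at hi
  rw [hu, totalDegree_mul_of_isDomain (left_ne_zero_of_mul hi) (right_ne_zero_of_mul hi)] at h1
  omega

/-- In a polynomial ring a prime of codimension at most one is generated by any prime element in
it. -/
theorem Ideal.eq_span_singleton_of_le_ringKrullDim {k : Type*} [Field k] {n : ℕ}
    {J : Ideal (MvPolynomial (Fin (n + 1)) k)} {F : MvPolynomial (Fin (n + 1)) k}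
    (hF : Prime F) (hFJ : F ∈ J)
    (hdim : (n : WithBot ℕ∞) ≤ ringKrullDim (MvPolynomial (Fin (n + 1)) k ⧸ J)) :
    J = Ideal.span {F} := by
  refine le_antisymm (fun f hf => ?_) ((Ideal.span_singleton_le_iff_mem _).mpr hFJ)
  by_contra hfF
  have hFp : (Ideal.span {F}).IsPrime := (Ideal.span_singleton_prime hF.ne_zero).mpr hF
  -- Passing to the quotient by `F`, and then by the further element `f` of `J`, would lower the
  -- dimension `n + 1` twice.
  have h1 := ringKrullDim_succ_le_of_surjective (Ideal.Quotient.mk (Ideal.span {F}))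
    Ideal.Quotient.mk_surjective (mem_nonZeroDivisors_of_ne_zero hF.ne_zero)
    (Ideal.Quotient.eq_zero_iff_mem.mpr (Ideal.mem_span_singleton_self F))
  have h2 := ringKrullDim_succ_le_of_surjective
    (Ideal.Quotient.factor ((Ideal.span_singleton_le_iff_mem J).mpr hFJ))
    (Ideal.Quotient.factor_surjective _) (r := Ideal.Quotient.mk _ f)
    (mem_nonZeroDivisors_of_ne_zero (by rwa [Ne, Ideal.Quotient.eq_zero_iff_mem]))
    (by rw [Ideal.Quotient.factor_mk, Ideal.Quotient.eq_zero_iff_mem]; exact hf)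
  rw [MvPolynomial.ringKrullDim_of_isNoetherianRing, ringKrullDim_eq_zero_of_field, zero_add,
    Nat.card_fin] at h1
  have h3 : ((n + 1 + 1 : ℕ) : WithBot ℕ∞) ≤ ((n + 1 : ℕ) : WithBot ℕ∞) := by
    refine le_trans ?_ h1
    push_cast
    gcongr
    refine le_trans ?_ h2
    gcongr
  rw [Nat.cast_le] at h3
  omega

end Auxiliary

/-! ### The conormal family and its generic member. -/

namespace SpaceCurve

variable {X : Set (PSpace 4)}

/-- Evaluation of a polynomial in two parameters with coefficients polynomials on the ambient
space. -/
noncomputable def evalFamily {R : Type*} [CommRing R] [Algebra ℂ R] (p : Fin 4 → R)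
    (σ : Fin 2 → R) : MvPolynomial (Fin 2) (MvPolynomial (Fin 4) ℂ) →+* R :=
  eval₂Hom (aeval p : MvPolynomial (Fin 4) ℂ →ₐ[ℂ] R).toRingHom σ

theorem evalFamily_eq_zero {R : Type*} [CommRing R] [Algebra ℂ R] {p : Fin 4 → R}
    (hp : ∀ f ∈ idealOf X, aeval p f = 0) (σ : Fin 2 → R)
    {P : MvPolynomial (Fin 2) (MvPolynomial (Fin 4) ℂ)} (hP : ∀ m, coeff m P ∈ idealOf X) :
    evalFamily p σ P = 0 := by
  rw [evalFamily, coe_eval₂Hom, eval₂_eq]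
  refine Finset.sum_eq_zero fun m _ => ?_
  have : (aeval p : MvPolynomial (Fin 4) ℂ →ₐ[ℂ] R).toRingHom (coeff m P) = 0 := hp _ (hP m)
  rw [this, zero_mul]

/-- Parameters independent over `K` force each coefficient to vanish at the generic point. This
carries identities from the generic conormal vector to actual ones. -/
theorem coeff_mem_idealOf_of_evalFamily_generic {K L : Type} [Field K] [Field L] [Algebra ℂ K]
    [Algebra ℂ L] [Algebra K L] [IsScalarTower ℂ K L] {x : Fin 4 → K}
    (hx : ∀ f, f ∈ idealOf X ↔ aeval x f = 0) {σ : Fin 2 → L} (hσ : AlgebraicIndependent K σ)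
    {P : MvPolynomial (Fin 2) (MvPolynomial (Fin 4) ℂ)}
    (hP : evalFamily (fun i => algebraMap K L (x i)) σ P = 0) (m : Fin 2 →₀ ℕ) :
    coeff m P ∈ idealOf X := by
  let φ : MvPolynomial (Fin 4) ℂ →+* K := (aeval x : MvPolynomial (Fin 4) ℂ →ₐ[ℂ] K).toRingHom
  have h1 : evalFamily (fun i => algebraMap K L (x i)) σ P = aeval σ (map φ P) := by
    rw [evalFamily, coe_eval₂Hom, aeval_def, eval₂_map]
    congr 1
    refine RingHom.ext fun f => ?_
    exact aeval_algebraMap_apply L x f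
  rw [h1] at hP
  have h2 := (injective_iff_map_eq_zero _).mp hσ _ hP
  have h3 := congrArg (coeff m) h2
  rw [coeff_map, coeff_zero] at h3
  exact (hx _).mpr h3

theorem coeff_mem_idealOf_of_evalFamily_points (hI : (idealOf X).IsPrime)
    {g : MvPolynomial (Fin 4) ℂ} (hg : g ∉ idealOf X)
    {P : MvPolynomial (Fin 2) (MvPolynomial (Fin 4) ℂ)}
    (hP : ∀ p ∈ cone X, aeval p g ≠ 0 → ∀ σ, evalFamily p σ P = 0) (m : Fin 2 →₀ ℕ) :
    coeff m P ∈ idealOf X := by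
  refine mem_idealOf_of_forall_ne_zero hI hg fun p hp hgp => ?_
  let φ : MvPolynomial (Fin 4) ℂ →+* ℂ := (aeval p : MvPolynomial (Fin 4) ℂ →ₐ[ℂ] ℂ).toRingHom
  have h1 : map φ P = 0 := by
    refine MvPolynomial.funext fun σ => ?_
    rw [eval_map, map_zero]
    exact hP p hp hgp σ
  have h2 := congrArg (coeff m) h1
  rwa [coeff_map, coeff_zero] at h2

namespace TangentFrame

variable (fr : TangentFrame X)

/-- The conormal vector with the given parameters. -/
noncomputable def conormal {R : Type*} [CommRing R] [Algebra ℂ R] (p : Fin 4 → R)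
    (σ : Fin 2 → R) : Fin 4 → R :=
  σ 0 • gradAt p fr.f₁ + σ 1 • gradAt p fr.f₂

/-- The pullback of a polynomial on the dual space to the conormal family. -/
noncomputable def pullback (f : MvPolynomial (Fin 4) ℂ) :
    MvPolynomial (Fin 2) (MvPolynomial (Fin 4) ℂ) :=
  aeval (fun i => MvPolynomial.X 0 * C (pderiv i fr.f₁) + MvPolynomial.X 1 * C (pderiv i fr.f₂)) f

theorem evalFamily_pullback {R : Type*} [CommRing R] [Algebra ℂ R] (p : Fin 4 → R)
    (σ : Fin 2 → R) (f : MvPolynomial (Fin 4) ℂ) :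
    evalFamily p σ (fr.pullback f) = aeval (fr.conormal p σ) f := by
  induction f using MvPolynomial.induction_on with
  | C a =>
    simp only [pullback, aeval_C, evalFamily]
    rw [IsScalarTower.algebraMap_apply ℂ (MvPolynomial (Fin 4) ℂ)]
    simp [MvPolynomial.algebraMap_eq]
  | add p q hp hq =>
    simp only [pullback, map_add] at *
    rw [hp, hq]
  | mul_X q i hq =>
    simp only [pullback, map_mul, aeval_X] at *
    rw [hq]
    simp [evalFamily, conormal]

theorem mem_idealOf_tangentHyperplanes' (hX : IsIrreducibleCurve X)
    (f : MvPolynomial (Fin 4) ℂ) :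
    f ∈ idealOf (tangentHyperplanes X) ↔ ∀ m, coeff m (fr.pullback f) ∈ idealOf X := by
  rw [fr.mem_idealOf_tangentHyperplanes hX]
  constructor
  · intro h
    refine coeff_mem_idealOf_of_evalFamily_points hX.irreducible fr.g_notMem fun p hp hg σ => ?_
    rw [evalFamily_pullback]
    exact h p hp hg _ _
  · intro h p hp _ s t
    have := evalFamily_eq_zero (cone_subset_affineCone X hp) ![s, t] h
    rwa [evalFamily_pullback] at this

section Generic

variable {K L : Type} [Field K] [Field L] [Algebra ℂ K]
    [Algebra ℂ L] [Algebra K L] [IsScalarTower ℂ K L] {x : Fin 4 → K}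
    (hx : ∀ f, f ∈ idealOf X ↔ aeval x f = 0) {σ : Fin 2 → L} (hσ : AlgebraicIndependent K σ)

theorem aeval_extend (f : MvPolynomial (Fin 4) ℂ) :
    aeval (fun i => algebraMap K L (x i)) f = algebraMap K L (aeval x f) :=
  aeval_algebraMap_apply L x f

include hx in
theorem aeval_extend_eq_zero {f : MvPolynomial (Fin 4) ℂ} (hf : f ∈ idealOf X) :
    aeval (fun i => algebraMap K L (x i)) f = 0 := by
  rw [aeval_extend, (hx f).mp hf, map_zero]

include hx hσ in
-- The conormal vector at `x` with independent parameters is a generic point of the dual variety.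
theorem mem_idealOf_tangentHyperplanes_generic (hX : IsIrreducibleCurve X)
    (f : MvPolynomial (Fin 4) ℂ) : f ∈ idealOf (tangentHyperplanes X) ↔
      aeval (fr.conormal (fun i => algebraMap K L (x i)) σ) f = 0 := by
  rw [fr.mem_idealOf_tangentHyperplanes' hX, ← evalFamily_pullback]
  exact ⟨fun h => evalFamily_eq_zero (fun f hf => aeval_extend_eq_zero hx hf) σ h,
    fun h => coeff_mem_idealOf_of_evalFamily_generic hx hσ h⟩

/-- The tangent space of the dual variety at the generic conormal vector. -/
def dualTangent (h : Fin 4 → L) (J : Ideal (MvPolynomial (Fin 4) ℂ)) :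
    Submodule L (Fin 4 → L) where
  carrier := {w | ∀ f ∈ J, gradAt h f ⬝ᵥ w = 0}
  zero_mem' := fun f _ => by simp
  add_mem' := fun ha hb f hf => by rw [dotProduct_add, ha f hf, hb f hf, add_zero]
  smul_mem' := fun c a ha f hf => by rw [dotProduct_smul, ha f hf, smul_zero]

theorem derivation_mem_dualTangent {h : Fin 4 → L} {J : Ideal (MvPolynomial (Fin 4) ℂ)}
    (hJ : ∀ f, f ∈ J ↔ aeval h f = 0) (D : Derivation ℂ L L) :
    (fun i => D (h i)) ∈ dualTangent h J := by
  intro f hf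
  rw [← D.apply_aeval_eq_dotProduct, (hJ f).mp hf, map_zero]

include hx in
theorem conormal_dotProduct_self :
    fr.conormal (fun i => algebraMap K L (x i)) σ ⬝ᵥ (fun i => algebraMap K L (x i)) = 0 := by
  rw [conormal, add_dotProduct, smul_dotProduct, smul_dotProduct,
    gradAt_dotProduct_self (fun f hf => aeval_extend_eq_zero hx hf) fr.f₁_mem,
    gradAt_dotProduct_self (fun f hf => aeval_extend_eq_zero hx hf) fr.f₂_mem, smul_zero,
    smul_zero, add_zero]

include hx in
theorem conormal_dotProduct_tau :
    fr.conormal (fun i => algebraMap K L (x i)) σ ⬝ᵥ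
      fr.tau (fun i => algebraMap K L (x i)) = 0 := by
  rw [conormal, add_dotProduct, smul_dotProduct, smul_dotProduct,
    fr.gradAt_dotProduct_tau (fun f hf => aeval_extend_eq_zero hx hf) fr.f₁_mem,
    fr.gradAt_dotProduct_tau (fun f hf => aeval_extend_eq_zero hx hf) fr.f₂_mem, smul_zero,
    smul_zero, add_zero]

include hx in
/-- The generic point of the curve is orthogonal to the dual tangent space. -/
theorem dotProduct_eq_zero_of_mem_dualTangent {J : Ideal (MvPolynomial (Fin 4) ℂ)}
    (hJ : ∀ f, f ∈ J ↔ aeval (fr.conormal (fun i => algebraMap K L (x i)) σ) f = 0)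
    {w : Fin 4 → L} (hw : w ∈ dualTangent (fr.conormal (fun i => algebraMap K L (x i)) σ) J) :
    w ⬝ᵥ (fun i => algebraMap K L (x i)) = 0 := by
  -- Realize `w` as `D h` and differentiate `h ⬝ x = 0`. The term `h ⬝ D x` vanishes because `h` is
  -- a combination of gradients of equations of `X`.
  obtain ⟨D, hD⟩ := exists_derivation_apply_eq (k := ℂ)
    (fr.conormal (fun i => algebraMap K L (x i)) σ) w fun f hf => hw f ((hJ f).mpr hf)
  have h1 := D.apply_dotProduct (fr.conormal (fun i => algebraMap K L (x i)) σ)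
    (fun i => algebraMap K L (x i))
  have h2 : ∀ f ∈ idealOf X, gradAt (fun i => algebraMap K L (x i)) f ⬝ᵥ
      (fun i => D (algebraMap K L (x i))) = 0 := by
    intro f hf
    rw [← D.apply_aeval_eq_dotProduct, aeval_extend_eq_zero hx hf, map_zero]
  rw [fr.conormal_dotProduct_self hx, map_zero] at h1
  simp only [hD] at h1
  have h3 : fr.conormal (fun i => algebraMap K L (x i)) σ ⬝ᵥ
      (fun i => D (algebraMap K L (x i))) = 0 := by
    rw [conormal, add_dotProduct, smul_dotProduct, smul_dotProduct, h2 _ fr.f₁_mem,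
      h2 _ fr.f₂_mem, smul_zero, smul_zero, add_zero]
  rw [h3, add_zero] at h1
  exact h1.symm

include hσ in
-- Derivations over `K` fix `x` and move the parameters freely, so the conormal plane lies in the
-- dual tangent space.
theorem gradAt_mem_dualTangent {J : Ideal (MvPolynomial (Fin 4) ℂ)}
    (hJ : ∀ f, f ∈ J ↔ aeval (fr.conormal (fun i => algebraMap K L (x i)) σ) f = 0) (c : Fin 2 → L) :
    c 0 • gradAt (fun i => algebraMap K L (x i)) fr.f₁ +
      c 1 • gradAt (fun i => algebraMap K L (x i)) fr.f₂ ∈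
      dualTangent (fr.conormal (fun i => algebraMap K L (x i)) σ) J := by
  have : CharZero K := charZero_of_injective_algebraMap (algebraMap ℂ K).injective
  obtain ⟨D, hD⟩ := exists_derivation_apply_eq (k := K) σ c fun f hf => by
    rw [(injective_iff_map_eq_zero _).mp hσ f hf]; simp
  have hmem := derivation_mem_dualTangent hJ (D.restrictScalars ℂ)
  convert hmem using 1
  ext i
  simp only [conormal, Pi.add_apply, Pi.smul_apply, smul_eq_mul, gradAt_apply,
    aeval_extend, Derivation.restrictScalars_apply, map_add, Derivation.leibniz, hD,
    Derivation.map_algebraMap]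
  ring

include hx hσ in
/-- If the dual variety is not a hypersurface, then the tangent lines are constant. -/
theorem gradAt_dotProduct_derivation_tau {J : Ideal (MvPolynomial (Fin 4) ℂ)}
    (hJ : ∀ f, f ∈ J ↔ aeval (fr.conormal (fun i => algebraMap K L (x i)) σ) f = 0)
    (hrank : Module.finrank L
      (dualTangent (fr.conormal (fun i => algebraMap K L (x i)) σ) J) ≤ 2)
    (D₀ : Derivation ℂ K K) :
    gradAt x fr.f₁ ⬝ᵥ (fun i => D₀ (fr.tau x i)) = 0 ∧
      gradAt x fr.f₂ ⬝ᵥ (fun i => D₀ (fr.tau x i)) = 0 := by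
  have hg : aeval (fun i => algebraMap K L (x i)) fr.g ≠ 0 := by
    rw [aeval_extend, Ne, map_eq_zero_iff _ (algebraMap K L).injective, ← hx]
    exact fr.g_notMem
  -- The two gradients already span dimension 2, so the rank bound leaves nothing else.
  have hspan : Submodule.span L {gradAt (fun i => algebraMap K L (x i)) fr.f₁,
      gradAt (fun i => algebraMap K L (x i)) fr.f₂} =
      dualTangent (fr.conormal (fun i => algebraMap K L (x i)) σ) J := by
    refine Submodule.eq_of_le_of_finrank_le ?_ ?_
    · intro w hw
      rw [Submodule.mem_span_pair] at hw
      obtain ⟨a, b, rfl⟩ := hw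
      exact fr.gradAt_mem_dualTangent hσ hJ ![a, b]
    · have := finrank_span_eq_card (fr.linearIndependent_grad _ hg)
      rw [Matrix.range_cons, Matrix.range_cons, Matrix.range_empty, Set.union_empty,
        Set.singleton_union, Fintype.card_fin] at this
      rw [this]
      exact hrank
  -- `D` extends the motion `D₀` of `x` to `L`. Since `D h` is again conormal, differentiating `h ⬝
  -- τ = 0` leaves `h ⬝ D τ = 0`.
  obtain ⟨D, hD⟩ := exists_derivation_apply_eq (k := ℂ) (fun i => algebraMap K L (x i))
    (fun i => algebraMap K L (D₀ (x i))) fun f hf => by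
      rw [aeval_extend, map_eq_zero_iff _ (algebraMap K L).injective] at hf
      have := D₀.apply_aeval_mvPolynomial x f
      rw [hf, map_zero] at this
      simp only [aeval_extend, ← map_mul, ← map_sum, ← this, map_zero]
  have hDtau : ∀ i, D (fr.tau (fun i => algebraMap K L (x i)) i) =
      algebraMap K L (D₀ (fr.tau x i)) := by
    intro i
    rw [tau, tau, D.apply_aeval_mvPolynomial, D₀.apply_aeval_mvPolynomial]
    simp only [hD, aeval_extend, map_sum, map_mul]
  have hmem := derivation_mem_dualTangent hJ D
  rw [← hspan, Submodule.mem_span_pair] at hmem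
  obtain ⟨a, b, hab⟩ := hmem
  have h1 := D.apply_dotProduct (fr.conormal (fun i => algebraMap K L (x i)) σ)
    (fr.tau (fun i => algebraMap K L (x i)))
  rw [fr.conormal_dotProduct_tau hx, map_zero, ← hab, add_dotProduct, smul_dotProduct,
    smul_dotProduct,
    fr.gradAt_dotProduct_tau (fun f hf => aeval_extend_eq_zero hx hf) fr.f₁_mem,
    fr.gradAt_dotProduct_tau (fun f hf => aeval_extend_eq_zero hx hf) fr.f₂_mem, smul_zero,
    smul_zero, add_zero, zero_add] at h1
  have hdot : ∀ f : MvPolynomial (Fin 4) ℂ, gradAt (fun i => algebraMap K L (x i)) f ⬝ᵥ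
      (fun i => D (fr.tau (fun i => algebraMap K L (x i)) i)) =
      algebraMap K L (gradAt x f ⬝ᵥ fun i => D₀ (fr.tau x i)) := by
    intro f
    simp only [dotProduct, gradAt_apply, hDtau, aeval_extend, map_sum, map_mul]
  rw [conormal, add_dotProduct, smul_dotProduct, smul_dotProduct, hdot, hdot] at h1
  -- The relation is linear in the parameters with coefficients in `K`, so both coefficients vanish.
  have hind := Fintype.linearIndependent_iff.mp hσ.linearIndependent
    ![gradAt x fr.f₁ ⬝ᵥ fun i => D₀ (fr.tau x i), gradAt x fr.f₂ ⬝ᵥ fun i => D₀ (fr.tau x i)] (by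
      rw [Fin.sum_univ_two]
      simp only [Matrix.cons_val_zero, Matrix.cons_val_one, Algebra.smul_def]
      rw [h1]
      simp only [smul_eq_mul]
      ring)
  exact ⟨hind 0, hind 1⟩

include hx in
-- Both `D x` and `D τ` stay in the span of `x` and `τ`, so `D` multiplies all Plücker coordinates
-- of the tangent line by one factor. Their ratios are therefore constants, and the tangent line is
-- fixed.
theorem isLine_of_gradAt_dotProduct_derivation_tau (hX : IsIrreducibleCurve X)
    (h : ∀ D₀ : Derivation ℂ K K, gradAt x fr.f₁ ⬝ᵥ (fun i => D₀ (fr.tau x i)) = 0 ∧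
      gradAt x fr.f₂ ⬝ᵥ (fun i => D₀ (fr.tau x i)) = 0) : IsLine X := by
  have hg : aeval x fr.g ≠ 0 := by
    rw [Ne, ← hx]
    exact fr.g_notMem
  have hx' : ∀ f ∈ idealOf X, aeval x f = 0 := fun f hf => (hx f).mp hf
  obtain ⟨i, j, hij⟩ := exists_minor_ne_zero (fr.linearIndependent_τ x hg)
  change x i * fr.tau x j - x j * fr.tau x i ≠ 0 at hij
  have hconst : ∀ a b, ∃ c : ℂ, algebraMap ℂ K c =
      (x a * fr.tau x b - x b * fr.tau x a) / (x i * fr.tau x j - x j * fr.tau x i) := by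
    intro a b
    refine mem_range_algebraMap_of_derivation_eq_zero _ fun D => ?_
    obtain ⟨α, β, hαβ⟩ := fr.exists_eq_of_tangent hx' hg (h D).1 (h D).2
    obtain ⟨γ, δ, hγδ⟩ := fr.exists_eq_of_tangent hx' hg (w := fun i => D (x i))
      (by rw [← D.apply_aeval_eq_dotProduct, hx' _ fr.f₁_mem, map_zero])
      (by rw [← D.apply_aeval_eq_dotProduct, hx' _ fr.f₂_mem, map_zero])
    have h1 : ∀ k, D (fr.tau x k) = α * x k + β * fr.tau x k :=
      fun k => (congrFun hαβ k).symm
    have h2 : ∀ k, D (x k) = γ * x k + δ * fr.tau x k :=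
      fun k => (congrFun hγδ k).symm
    have h3 : ∀ a b, D (x a * fr.tau x b - x b * fr.tau x a) =
        (γ + β) * (x a * fr.tau x b - x b * fr.tau x a) := by
      intro a b
      simp only [map_sub, Derivation.leibniz, smul_eq_mul, h1, h2]
      ring
    rw [Derivation.leibniz_div, h3, h3]
    simp only [smul_eq_mul]
    ring
  choose c hc using hconst
  -- With `p a b = x a * τ b - x b * τ a`, this is the identity `x k * p i j = x j * p i k - x i * p
  -- j k`.
  refine hX.isLine_of_linear fr i j (c i) (c j) fun k => ?_
  rw [hx]
  simp only [map_sub, map_mul, aeval_X, aeval_C, hc]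
  rw [sub_eq_zero, div_mul_eq_mul_div, div_mul_eq_mul_div, ← sub_div, eq_div_iff hij]
  ring

end Generic

/-! ### The equation of the dual surface and biduality. -/

/-- Properties of an equation of the dual surface. -/
structure IsDualEquation (F : MvPolynomial (Fin 4) ℂ) : Prop where
  prime : Prime F
  idealOf_eq : idealOf (tangentHyperplanes X) = Ideal.span {F}
  degree_pos : 0 < F.totalDegree
  gauss_mem : ∀ h, aeval h F = 0 → gradAt h F ∈ affineCone X
  gauss_self : ∀ h : Fin 4 → ℂ, aeval h F = 0 → h ⬝ᵥ gradAt h F = 0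
  gauss_tau : ∀ h : Fin 4 → ℂ, aeval h F = 0 → h ⬝ᵥ fr.tau (gradAt h F) = 0
  not_dvd : ¬ F ∣ aeval (fun i => pderiv i F) fr.g

theorem exists_gradAt_eq_smul_of_minors {p u : Fin 4 → ℂ} (hp : p ≠ 0)
    (h : ∀ i j, p i * u j - p j * u i = 0) : ∃ c : ℂ, u = c • p := by
  obtain ⟨i, hi⟩ := Function.ne_iff.mp hp
  refine ⟨u i / p i, ?_⟩
  ext j
  have := h i j
  simp only [Pi.smul_apply, smul_eq_mul]
  rw [div_mul_eq_mul_div, eq_div_iff hi]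
  linear_combination this

/-- As `X` is not a line, the dual cone has dimension at least 3, so a prime element of its nonzero
ideal generates it. Biduality at the generic conormal vector is then specialized to all zeros of
`F`. -/
theorem exists_isDualEquation (hX : IsIrreducibleCurve X) (hline : ¬ IsLine X) :
    ∃ F, fr.IsDualEquation F := by
  obtain ⟨K, _, _, x, hx, -⟩ := hX.irreducible.exists_genericPoint
  let L := FractionRing (MvPolynomial (Fin 2) K)
  let σ : Fin 2 → L := fun i => algebraMap (MvPolynomial (Fin 2) K) L (MvPolynomial.X i)
  have hσ : AlgebraicIndependent K σ := by
    have h1 := (algebraicIndependent_X (Fin 2) K).map' (f := IsScalarTower.toAlgHom K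
      (MvPolynomial (Fin 2) K) L) (IsFractionRing.injective (MvPolynomial (Fin 2) K) L)
    exact h1
  let xL : Fin 4 → L := fun i => algebraMap K L (x i)
  let h := fr.conormal xL σ
  let J := idealOf (tangentHyperplanes X)
  have hJ : ∀ f, f ∈ J ↔ aeval h f = 0 := fr.mem_idealOf_tangentHyperplanes_generic hx hσ hX
  have hJprime : J.IsPrime := by
    have : J = RingHom.ker (aeval h : MvPolynomial (Fin 4) ℂ →ₐ[ℂ] L) := by
      ext f; rw [hJ]; rfl
    rw [this]; exact RingHom.ker_isPrime _
  have hrank : 3 ≤ Module.finrank L (dualTangent h J) := by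
    by_contra hcon
    exact hline (fr.isLine_of_gradAt_dotProduct_derivation_tau hx hX
      (fr.gradAt_dotProduct_derivation_tau hx hσ hJ (Nat.lt_succ_iff.mp (not_le.mp hcon))))
  have hdim : ((3 : ℕ) : WithBot ℕ∞) ≤ ringKrullDim (MvPolynomial (Fin 4) ℂ ⧸ J) :=
    le_trans (by exact_mod_cast hrank)
      (finrank_le_ringKrullDim_quotient h J hJ (dualTangent h J) fun w hw => hw)
  have hxL : xL ≠ 0 := by
    have : aeval xL fr.g ≠ 0 := by
      rw [aeval_extend, Ne, map_eq_zero_iff _ (algebraMap K L).injective, ← hx]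
      exact fr.g_notMem
    exact (fr.linearIndependent_τ xL this).ne_zero 0
  have horth : ∀ w ∈ dualTangent h J, w ⬝ᵥ xL = 0 := fun w hw =>
    fr.dotProduct_eq_zero_of_mem_dualTangent hx hJ hw
  -- Otherwise every vector would be tangent to the dual variety, hence orthogonal to `xL`.
  have hJbot : J ≠ ⊥ := by
    intro hbot
    refine hxL (funext fun i => ?_)
    have := horth (Pi.single i 1) fun f hf => by
      rw [hbot, Ideal.mem_bot] at hf
      rw [hf]; simp [dotProduct]
    simpa using this
  obtain ⟨F, hFJ, hF⟩ := hJprime.exists_mem_prime_of_ne_bot hJbot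
  have hspan : J = Ideal.span {F} := Ideal.eq_span_singleton_of_le_ringKrullDim hF hFJ hdim
  have hdeg : 0 < F.totalDegree := by
    rw [pos_iff_ne_zero]
    intro h0
    rw [totalDegree_eq_zero_iff_eq_C] at h0
    refine hF.not_isUnit ?_
    rw [h0]
    refine (isUnit_iff_ne_zero.mpr fun hc => hF.ne_zero ?_).map C
    rw [h0, hc, map_zero]
  have hhom := isHomogeneous_of_idealOf_eq_span hspan hF.ne_zero
  obtain ⟨i₀, hi₀⟩ := exists_pderiv_ne_zero hhom hdeg
  have hpd : pderiv i₀ F ∉ J := by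
    rw [hspan, Ideal.mem_span_singleton]
    exact not_dvd_pderiv hhom hdeg hi₀
  -- Biduality: the dual tangent space is the orthogonal of `gradAt h F`, and `xL` is orthogonal to
  -- it.
  have hxspan : xL ∈ Submodule.span L {gradAt h F} := by
    refine mem_of_forall_dotProduct_eq_zero _ _ fun w hw => ?_
    rw [dotProduct_comm]
    refine horth w fun f hf => ?_
    rw [hspan, Ideal.mem_span_singleton] at hf
    obtain ⟨u, rfl⟩ := hf
    rw [gradAt_mul, (hJ F).mp hFJ, zero_smul, zero_add, smul_dotProduct,
      hw _ (Submodule.mem_span_singleton_self _), smul_zero]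
  obtain ⟨c, hc⟩ := Submodule.mem_span_singleton.mp hxspan
  -- Proportionality is expressed by minors, whose pullbacks to the conormal family vanish
  -- generically, hence at every good point. The factor `c` may be zero.
  have hbid : ∀ p ∈ cone X, aeval p fr.g ≠ 0 → ∀ s t : ℂ,
      ∃ c : ℂ, gradAt (s • gradAt p fr.f₁ + t • gradAt p fr.f₂) F = c • p := by
    intro p hp hg s t
    refine exists_gradAt_eq_smul_of_minors (fr.ne_zero_of_good hg) fun i j => ?_
    let P := C (MvPolynomial.X i) * fr.pullback (pderiv j F) -
      C (MvPolynomial.X j) * fr.pullback (pderiv i F)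
    have hP : ∀ {R : Type} [CommRing R] [Algebra ℂ R] (p : Fin 4 → R) (σ : Fin 2 → R),
        evalFamily p σ P = p i * gradAt (fr.conormal p σ) F j -
          p j * gradAt (fr.conormal p σ) F i := by
      intro R _ _ p σ
      simp only [P, map_sub, map_mul, evalFamily_pullback, gradAt_apply]
      simp [evalFamily]
    have h0 : evalFamily xL σ P = 0 := by
      rw [hP]
      change xL i * gradAt h F j - xL j * gradAt h F i = 0
      rw [← hc]
      simp only [Pi.smul_apply, smul_eq_mul]
      ring
    have h1 := evalFamily_eq_zero (cone_subset_affineCone X hp) ![s, t]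
      (coeff_mem_idealOf_of_evalFamily_generic hx hσ h0)
    rwa [hP] at h1
  have hmem : ∀ f : MvPolynomial (Fin 4) ℂ, (∀ p ∈ cone X, aeval p fr.g ≠ 0 → ∀ s t : ℂ,
      aeval (s • gradAt p fr.f₁ + t • gradAt p fr.f₂) f = 0) →
      ∀ v : Fin 4 → ℂ, aeval v F = 0 → aeval v f = 0 := by
    intro f hf v hv
    have h1 := (fr.mem_idealOf_tangentHyperplanes hX f).mpr hf
    change f ∈ J at h1
    rw [hspan, Ideal.mem_span_singleton] at h1
    obtain ⟨u, rfl⟩ := h1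
    rw [map_mul, hv, zero_mul]
  refine ⟨F, hF, hspan, hdeg, fun v hv f hf => ?_, fun v hv => ?_, fun v hv => ?_, fun hdvd => ?_⟩
  · have := hmem (aeval (fun i => pderiv i F) f) (fun p hp hg s t => by
      obtain ⟨c, hc⟩ := hbid p hp hg s t
      rw [aeval_aeval]
      change aeval (gradAt _ F) f = 0
      rw [hc]
      exact smul_mem_affineCone (cone_subset_affineCone X hp) c f hf) v hv
    rwa [aeval_aeval] at this
  · rw [dotProduct_comm, dotProduct_gradAt_of_isHomogeneous hhom, hv, mul_zero]
  · have := hmem (∑ i, MvPolynomial.X i * aeval (fun i => pderiv i F) (fr.τ i))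
      (fun p hp hg s t => by
        obtain ⟨c, hc⟩ := hbid p hp hg s t
        have hp' := cone_subset_affineCone X hp
        simp only [map_sum, map_mul, aeval_X, aeval_aeval]
        change _ ⬝ᵥ fr.tau (gradAt _ F) = 0
        rw [hc, fr.tau_smul, dotProduct_smul, add_dotProduct, smul_dotProduct, smul_dotProduct,
          fr.gradAt_dotProduct_tau hp' fr.f₁_mem, fr.gradAt_dotProduct_tau hp' fr.f₂_mem]
        simp) v hv
    simp only [map_sum, map_mul, aeval_X, aeval_aeval] at this
    exact this
  -- Divisibility gives `g (c • p) = 0` with `g p ≠ 0`, so `c = 0`. Then a nonzero partial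
  -- derivative of `F` would vanish on the whole dual surface.
  · have h1 : pderiv i₀ F ∈ J := (fr.mem_idealOf_tangentHyperplanes hX _).mpr fun p hp hg s t => by
      obtain ⟨c, hc⟩ := hbid p hp hg s t
      have h2 : aeval (fun i => pderiv i F) fr.g ∈ J := by
        rw [hspan, Ideal.mem_span_singleton]; exact hdvd
      have h3 := (fr.mem_idealOf_tangentHyperplanes hX _).mp h2 p hp hg s t
      rw [aeval_aeval] at h3
      change aeval (gradAt _ F) fr.g = 0 at h3
      rw [hc] at h3
      have h4 : c ^ (fr.degG + 1) * aeval p fr.g = 0 := by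
        rw [← fr.isHomogeneous_g.aeval_mul]; exact h3
      have hc0 : c = 0 := by
        have := (mul_eq_zero.mp h4).resolve_right hg
        exact pow_eq_zero_iff (Nat.succ_ne_zero _) |>.mp this
      have := congrFun hc i₀
      rw [hc0, zero_smul] at this
      exact this
    exact hpd h1

end TangentFrame

end SpaceCurve

/-! ### Points and dimension of hypersurfaces; general linear forms. -/

section Hypersurfaces

theorem MvPolynomial.exists_homogeneousComponent_ne_zero {σ R : Type*} [CommSemiring R]
    {f : MvPolynomial σ R} (hf : f ≠ 0) : ∃ d, homogeneousComponent d f ≠ 0 := by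
  by_contra! hcon
  refine hf ?_
  rw [← sum_homogeneousComponent f]
  exact Finset.sum_eq_zero fun d _ => hcon d

theorem MvPolynomial.dvd_of_forall_aeval_eq_zero {n : ℕ} {Ψ f : MvPolynomial (Fin n) ℂ}
    (hΨ : Prime Ψ) (h : ∀ y : Fin n → ℂ, aeval y Ψ = 0 → aeval y f = 0) : Ψ ∣ f := by
  have : (Ideal.span {Ψ}).IsPrime := (Ideal.span_singleton_prime hΨ.ne_zero).mpr hΨ
  rw [← Ideal.mem_span_singleton,
    ← MvPolynomial.IsPrime.vanishingIdeal_zeroLocus (K := ℂ) (Ideal.span {Ψ})]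
  intro y hy
  exact h y (hy Ψ (Ideal.mem_span_singleton_self Ψ))

/-- Omit a variable that occurs in `Ψ`: a nonzero multiple of `Ψ` still involves it. -/
theorem MvPolynomial.exists_algebraicIndependent_quotient {n : ℕ}
    {Ψ : MvPolynomial (Fin (n + 1)) ℂ} (hΨ : Prime Ψ) : ∃ i : Fin (n + 1),
    AlgebraicIndependent ℂ fun j : Fin n => Ideal.Quotient.mk (Ideal.span {Ψ}) (X (i.succAbove j))
    := by
  obtain ⟨i, hi⟩ : ∃ i, degreeOf i Ψ ≠ 0 := by
    by_contra! hcon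
    have h1 : Ψ.vars = ∅ := Finset.eq_empty_of_forall_notMem fun i hi =>
      mem_vars_iff_degreeOf_ne_zero.mp hi (hcon i)
    refine hΨ.not_isUnit ?_
    obtain ⟨c, rfl⟩ : ∃ c, Ψ = C c := ⟨_, vars_eq_empty_iff_eq_C.mp h1⟩
    refine (isUnit_iff_ne_zero.mpr fun h0 => hΨ.ne_zero ?_).map C
    rw [h0, map_zero]
  refine ⟨i, (injective_iff_map_eq_zero _).mpr fun q hq => ?_⟩
  by_contra hq0
  have h1 : Ideal.Quotient.mk (Ideal.span {Ψ}) (rename i.succAbove q) = 0 := by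
    rw [← hq, rename_eq_aeval, ← Ideal.Quotient.mkₐ_eq_mk ℂ, ← AlgHom.comp_apply, comp_aeval]
    rfl
  rw [Ideal.Quotient.eq_zero_iff_mem, Ideal.mem_span_singleton] at h1
  obtain ⟨u, hu⟩ := h1
  have h2 : rename i.succAbove q ≠ 0 :=
    (map_ne_zero_iff _ (rename_injective _ i.succAbove_right_injective)).mpr hq0
  have h3 : degreeOf i (rename i.succAbove q) = 0 := by
    by_contra hcon
    have hi := mem_vars_iff_degreeOf_ne_zero.mpr hcon
    obtain ⟨j, -, hj⟩ := Finset.mem_image.mp (vars_rename _ _ hi)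
    exact i.succAbove_ne j hj
  rw [hu] at h2 h3
  rw [degreeOf_mul_eq (left_ne_zero_of_mul h2) (right_ne_zero_of_mul h2)] at h3
  omega

theorem MvPolynomial.natCast_le_ringKrullDim_quotient_span {n : ℕ}
    {Ψ : MvPolynomial (Fin (n + 1)) ℂ} (hΨ : Prime Ψ) :
    (n : WithBot ℕ∞) ≤ ringKrullDim (MvPolynomial (Fin (n + 1)) ℂ ⧸ Ideal.span {Ψ}) := by
  have : (Ideal.span {Ψ}).IsPrime := (Ideal.span_singleton_prime hΨ.ne_zero).mpr hΨ
  obtain ⟨i, hi⟩ := exists_algebraicIndependent_quotient hΨ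
  exact hi.natCast_le_ringKrullDim

/-- Were the origin the only possible zero, every variable would be a multiple of `Ψ`, against
independence. -/
theorem MvPolynomial.exists_ne_zero_aeval_eq_zero {n : ℕ}
    {Ψ : MvPolynomial (Fin (n + 2)) ℂ} (hΨ : Prime Ψ) :
    ∃ y : Fin (n + 2) → ℂ, y ≠ 0 ∧ aeval y Ψ = 0 := by
  by_contra! hcon
  obtain ⟨i, hi⟩ := exists_algebraicIndependent_quotient hΨ
  refine hi.ne_zero 0 ?_
  rw [Ideal.Quotient.eq_zero_iff_mem, Ideal.mem_span_singleton]
  refine dvd_of_forall_aeval_eq_zero hΨ fun y hy => ?_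
  by_cases h0 : y = 0
  · rw [h0]; simp
  · exact absurd hy (hcon y h0)

/-- A general linear form vanishes on no component of positive dimension of a given variety. -/
theorem MvPolynomial.exists_polynomial_linearForm_notMem_minimalPrimes {n : ℕ}
    (S : Ideal (MvPolynomial (Fin (n + 1)) ℂ)) :
    ∃ Λ : MvPolynomial (Fin (n + 1)) ℂ, Λ ≠ 0 ∧ (∃ d, Λ.IsHomogeneous d) ∧
      ∀ v : Fin (n + 1) → ℂ, aeval v Λ ≠ 0 → ∀ P ∈ S.minimalPrimes, ∀ c : Fin (n + 1) → ℂ,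
        c ≠ 0 → (∀ f ∈ P, aeval c f = 0) → ∑ i, C (v i) * X i ∉ P := by
  classical
  -- One nonzero zero of each minimal prime suffices: the form with coefficients `v` avoids `P` once
  -- it is nonzero there. `Λ` is the product of these conditions; `1` is a filler when `P` has no
  -- such zero.
  have hch : ∀ P : Ideal (MvPolynomial (Fin (n + 1)) ℂ), ∃ c : Fin (n + 1) → ℂ, c ≠ 0 ∧
      ((∃ c : Fin (n + 1) → ℂ, c ≠ 0 ∧ ∀ f ∈ P, aeval c f = 0) → ∀ f ∈ P, aeval c f = 0) := by
    intro P
    by_cases h : ∃ c : Fin (n + 1) → ℂ, c ≠ 0 ∧ ∀ f ∈ P, aeval c f = 0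
    · obtain ⟨c, hc, hP⟩ := h
      exact ⟨c, hc, fun _ => hP⟩
    · exact ⟨1, one_ne_zero, fun h' => absurd h' h⟩
  choose c hc0 hc using hch
  let T := (Ideal.finite_minimalPrimes_of_isNoetherianRing _ S).toFinset
  refine ⟨∏ P ∈ T, ∑ i, C (c P i) * X i, ?_, ⟨_, IsHomogeneous.prod _ _ _ fun P _ =>
    IsHomogeneous.sum _ _ 1 fun i _ => isHomogeneous_C_mul_X _ _⟩, fun v hv P hP d hd0 hd hmem => ?_⟩
  · refine Finset.prod_ne_zero_iff.mpr fun P _ h0 => hc0 P ?_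
    ext i
    have := congrArg (aeval (Pi.single i (1 : ℂ))) h0
    simpa [Pi.single_apply] using this
  · rw [map_prod, Finset.prod_ne_zero_iff] at hv
    refine hv P (by simpa [T] using hP) ?_
    have := hc P ⟨d, hd0, hd⟩ _ hmem
    simp only [map_sum, map_mul, aeval_X, aeval_C] at this ⊢
    rw [← this]
    exact Finset.sum_congr rfl fun i _ => mul_comm _ _

theorem linSubst_transpose_surjective {m n : ℕ} {M : Matrix (Fin m) (Fin n) ℂ}
    {N : Matrix (Fin n) (Fin m) ℂ} (h : M * N = 1) : Function.Surjective (linSubst M.transpose) :=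
    by
  intro f
  refine ⟨linSubst N.transpose f, MvPolynomial.funext fun v => ?_⟩
  change aeval v _ = aeval v f
  rw [aeval_linSubst, aeval_linSubst]
  simp [Algebra.algebraMap_self, ← Matrix.transpose_mul, h]

end Hypersurfaces

/-! ### The tangent surface and sections by planes through the centre. -/

namespace SpaceCurve

variable {X : Set (PSpace 4)}

namespace TangentFrame

variable (fr : TangentFrame X)

/-- The points of the tangent lines lie on a surface. -/
theorem exists_equation_tangentDevelopable (hX : IsIrreducibleCurve X) :
    ∃ B : MvPolynomial (Fin 4) ℂ, B ≠ 0 ∧ (∃ d, B.IsHomogeneous d) ∧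
      ∀ p ∈ cone X, ∀ a b : ℂ, b ≠ 0 → aeval (a • p + b • fr.tau p) B = 0 := by
  have := hX.irreducible
  have hft : Algebra.FiniteType ℂ (Polynomial (CoordRing X)) :=
    Algebra.FiniteType.trans (S := CoordRing X) inferInstance inferInstance
  -- The generic point `T x + τ` of the tangent surface: four elements of a ring of dimension 3,
  -- hence algebraically dependent.
  let y : Fin 4 → Polynomial (CoordRing X) := fun i =>
    Polynomial.C (Ideal.Quotient.mk _ (MvPolynomial.X i)) * Polynomial.X +
      Polynomial.C (Ideal.Quotient.mk _ (fr.τ i))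
  have hy : ¬ AlgebraicIndependent ℂ y := by
    intro h
    have h1 := h.natCast_le_ringKrullDim
    rw [Polynomial.ringKrullDim_of_isNoetherianRing, hX.dim_eq] at h1
    have h2 : ((4 : ℕ) : WithBot ℕ∞) ≤ ((2 + 1 : ℕ) : WithBot ℕ∞) := by exact_mod_cast h1
    rw [Nat.cast_le] at h2
    omega
  obtain ⟨B, hB, hB0⟩ : ∃ B, aeval y B = 0 ∧ B ≠ 0 := by
    by_contra! hcon
    exact hy ((injective_iff_map_eq_zero _).mpr hcon)
  have h1 : ∀ p ∈ cone X, ∀ a : ℂ, aeval (a • p + fr.tau p) B = 0 := by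
    intro p hp a
    let φ : CoordRing X →+* ℂ := Ideal.Quotient.lift (idealOf X)
      (aeval p : MvPolynomial (Fin 4) ℂ →ₐ[ℂ] ℂ).toRingHom fun f hf => hf p hp
    have hφ : ∀ f, φ (Ideal.Quotient.mk _ f) = aeval p f := fun f => rfl
    have h2 := map_aeval y (Polynomial.eval₂RingHom φ a) B
    rw [hB, map_zero] at h2
    rw [h2, aeval_def, coe_eval₂Hom]
    congr 1
    · ext c
      · simp only [RingHom.comp_apply]
        rw [IsScalarTower.algebraMap_apply ℂ (CoordRing X) (Polynomial (CoordRing X))]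
        rw [Polynomial.algebraMap_eq, Polynomial.coe_eval₂RingHom, Polynomial.eval₂_C]
        change _ = φ (Ideal.Quotient.mk _ (C c))
        rw [hφ, aeval_C]
    · ext i
      simp only [y, Polynomial.coe_eval₂RingHom, Polynomial.eval₂_add, Polynomial.eval₂_mul,
        Polynomial.eval₂_C, Polynomial.eval₂_X, hφ, aeval_X, Pi.add_apply, Pi.smul_apply,
        smul_eq_mul, tau]
      ring
  have h2 : ∀ p ∈ cone X, ∀ a b : ℂ, b ≠ 0 → aeval (a • p + b • fr.tau p) B = 0 := by
    intro p hp a b hb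
    -- Replacing `p` by `l • p` multiplies `τ` by `l ^ (deg + 1) = b`.
    obtain ⟨l, hl⟩ := IsAlgClosed.exists_pow_nat_eq b (Nat.succ_pos fr.deg)
    have hl0 : l ≠ 0 := by rintro rfl; rw [zero_pow (Nat.succ_ne_zero _)] at hl; exact hb hl.symm
    have := h1 (l • p) (smul_mem_cone hp hl0) (a / l)
    rwa [fr.tau_smul, hl, smul_smul, div_mul_cancel₀ _ hl0] at this
  obtain ⟨d, hd⟩ := exists_homogeneousComponent_ne_zero hB0
  refine ⟨_, hd, ⟨d, homogeneousComponent_isHomogeneous d B⟩, fun p hp a b hb => ?_⟩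
  refine eval_homogeneousComponent_eq_zero B _ (fun c hc => ?_) d
  have := h2 p hp (c * a) (c * b) (mul_ne_zero hc hb)
  rwa [mul_smul, mul_smul, ← smul_add] at this

include fr in
theorem exists_isHomogeneous_mem_idealOf :
    ∃ f ∈ idealOf X, f ≠ 0 ∧ ∃ d, f.IsHomogeneous d := by
  obtain ⟨p, hp, hg⟩ := exists_mem_cone_ne_zero fr.g_notMem
  have h0 : fr.f₁ ≠ 0 := by
    intro h0
    refine (fr.linearIndependent_grad p hg).ne_zero 0 ?_
    ext i
    simp [h0]
  obtain ⟨d, hd⟩ := exists_homogeneousComponent_ne_zero h0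
  exact ⟨_, homogeneousComponent_mem_idealOf fr.f₁_mem d, hd, d,
    homogeneousComponent_isHomogeneous d _⟩

/-- The pullback of the equation of the dual surface to a general plane has no component along
which the Gauss map meets the bad points. -/
theorem IsDualEquation.not_dvd_linSubst {F : MvPolynomial (Fin 4) ℂ} (hF : fr.IsDualEquation F)
    {M : Matrix (Fin 3) (Fin 4) ℂ} {N : Matrix (Fin 4) (Fin 3) ℂ} (hMN : M * N = 1)
    {O : Fin 4 → ℂ} (hMO : M.mulVec O = 0)
    (hO : ∀ P ∈ (Ideal.span {F, aeval (fun i => pderiv i F) fr.g}).minimalPrimes,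
      ∀ c : Fin 4 → ℂ, c ≠ 0 → (∀ f ∈ P, aeval c f = 0) →
        ∑ i, C (O i) * MvPolynomial.X i ∉ P)
    {Ψ : MvPolynomial (Fin 3) ℂ} (hΨ : Prime Ψ) (hdvd : Ψ ∣ linSubst M.transpose F) :
    ¬ Ψ ∣ linSubst M.transpose (aeval (fun i => pderiv i F) fr.g) := by
  intro hdvd'
  let φ : MvPolynomial (Fin 4) ℂ →+* MvPolynomial (Fin 3) ℂ := (linSubst M.transpose).toRingHom
  let q := Ideal.Quotient.mk (Ideal.span {Ψ})
  have hprime : (Ideal.span {Ψ}).IsPrime := (Ideal.span_singleton_prime hΨ.ne_zero).mpr hΨ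
  have hle : Ideal.span {F, aeval (fun i => pderiv i F) fr.g} ≤ (Ideal.span {Ψ}).comap φ := by
    rw [Ideal.span_le]
    rintro f (rfl | rfl)
    · exact Ideal.mem_span_singleton.mpr hdvd
    · exact Ideal.mem_span_singleton.mpr hdvd'
  obtain ⟨P, hP, hPle⟩ := Ideal.exists_minimalPrimes_le hle
  have hPprime : P.IsPrime := hP.1.1
  have hFP : F ∈ P := hP.1.2 (Ideal.subset_span (Set.mem_insert _ _))
  have hQP := hP.1.2 (Ideal.subset_span (Set.mem_insert_of_mem _ (Set.mem_singleton _)))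
  obtain ⟨y, hy0, hy⟩ := exists_ne_zero_aeval_eq_zero hΨ
  -- A nonzero zero `y` of `Ψ` gives the nonzero zero `Mᵀ y` of `P`, so the genericity of `O`
  -- applies to `P`.
  have hℓ : ∑ i, C (O i) * MvPolynomial.X i ∉ P := by
    refine hO P hP (M.transpose.mulVec y) (fun h0 => hy0 ?_) fun f hf => ?_
    · have := congrArg (N.transpose.mulVec) h0
      rwa [Matrix.mulVec_mulVec, ← Matrix.transpose_mul, hMN, Matrix.transpose_one,
        Matrix.one_mulVec, Matrix.mulVec_zero] at this
    · obtain ⟨u, hu⟩ := Ideal.mem_span_singleton.mp (hPle hf)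
      change linSubst M.transpose f = Ψ * u at hu
      have := aeval_linSubst M.transpose y f
      rw [hu, map_mul, hy, zero_mul] at this
      simpa [Algebra.algebraMap_self] using this.symm
  have hφℓ : φ (∑ i, C (O i) * MvPolynomial.X i) = 0 := by
    refine MvPolynomial.funext fun v => ?_
    change aeval v (linSubst M.transpose _) = aeval v 0
    rw [aeval_linSubst]
    have h1 : O ⬝ᵥ M.transpose.mulVec v = 0 := by
      rw [Matrix.dotProduct_mulVec, Matrix.vecMul_transpose, hMO, zero_dotProduct]
    simpa [Algebra.algebraMap_self, dotProduct] using h1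
  have hFp : (Ideal.span {F}).IsPrime := (Ideal.span_singleton_prime hF.prime.ne_zero).mpr hF.prime
  have d1 := ringKrullDim_succ_le_of_surjective (Ideal.Quotient.mk (Ideal.span {F}))
    Ideal.Quotient.mk_surjective (mem_nonZeroDivisors_of_ne_zero hF.prime.ne_zero)
    (Ideal.Quotient.eq_zero_iff_mem.mpr (Ideal.mem_span_singleton_self F))
  have d2 := ringKrullDim_succ_le_of_surjective
    (Ideal.Quotient.factor ((Ideal.span_singleton_le_iff_mem P).mpr hFP))
    (Ideal.Quotient.factor_surjective _)
    (r := Ideal.Quotient.mk _ (aeval (fun i => pderiv i F) fr.g))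
    (mem_nonZeroDivisors_of_ne_zero (by
      rw [Ne, Ideal.Quotient.eq_zero_iff_mem, Ideal.mem_span_singleton]; exact hF.not_dvd))
    (by rw [Ideal.Quotient.factor_mk, Ideal.Quotient.eq_zero_iff_mem]; exact hQP)
  have d3 := ringKrullDim_succ_le_of_surjective
    (Ideal.Quotient.lift P (q.comp φ) fun f hf => Ideal.Quotient.eq_zero_iff_mem.mpr (hPle hf))
    (Ideal.Quotient.lift_surjective_of_surjective _ _
      (Ideal.Quotient.mk_surjective.comp (linSubst_transpose_surjective hMN)))
    (r := Ideal.Quotient.mk _ (∑ i, C (O i) * MvPolynomial.X i))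
    (mem_nonZeroDivisors_of_ne_zero (by rwa [Ne, Ideal.Quotient.eq_zero_iff_mem]))
    (by rw [Ideal.Quotient.lift_mk, RingHom.comp_apply, hφℓ, map_zero])
  have d4 := natCast_le_ringKrullDim_quotient_span hΨ
  rw [MvPolynomial.ringKrullDim_of_isNoetherianRing, ringKrullDim_eq_zero_of_field, zero_add,
    Nat.card_fin] at d1
  -- Three strict drops, by `F`, by the bad locus and by the linear form of `O`, would still leave
  -- the dimension at least 2 of the curve's cone `Ψ = 0`.
  have h3 : ((2 + 1 + 1 + 1 : ℕ) : WithBot ℕ∞) ≤ ((4 : ℕ) : WithBot ℕ∞) := by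
    refine le_trans ?_ d1
    rw [Nat.cast_succ]
    gcongr
    refine le_trans ?_ d2
    rw [Nat.cast_succ]
    gcongr
    refine le_trans ?_ d3
    rw [Nat.cast_succ]
    gcongr
  rw [Nat.cast_le] at h3
  omega

end TangentFrame

end SpaceCurve

/-! ### Squarefree divisibility and linear algebra of the camera. -/

section Auxiliary

theorem dvd_of_forall_prime_dvd {α : Type*} [CommMonoidWithZero α]
    [UniqueFactorizationMonoid α] {a b : α} (ha : a ≠ 0)
    (hsq : ∀ q, Prime q → q ∣ a → ¬ q * q ∣ a) (hb : ∀ q, Prime q → q ∣ a → q ∣ b) : a ∣ b := by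
  have key : ∀ c : α, c ∣ a → c ∣ b := by
    intro c
    induction c using WfDvdMonoid.induction_on_irreducible with
    | zero => exact fun h => absurd (zero_dvd_iff.mp h) ha
    | unit u hu => exact fun _ => hu.dvd
    | mul c i hc hi ih =>
      intro h
      have hi' := UniqueFactorizationMonoid.irreducible_iff_prime.mp hi
      have hia := (dvd_mul_right i c).trans h
      obtain ⟨w, rfl⟩ := ih ((dvd_mul_left c i).trans h)
      rcases hi'.dvd_or_dvd (hb i hi' hia) with h1 | h1
      · exact absurd ((mul_dvd_mul_left i h1).trans h) (hsq i hi' hia)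
      · rw [mul_comm i c]
        exact mul_dvd_mul_left c h1
  exact key a dvd_rfl

theorem exists_eq_smul_crossProduct {L : Type*} [Field L] {u v y : Fin 3 → L}
    (h : LinearIndependent L ![u, v]) (hu : y ⬝ᵥ u = 0) (hv : y ⬝ᵥ v = 0) :
    ∃ c : L, y = c • crossProduct u v := by
  have h0 := crossProduct_ne_zero_iff_linearIndependent.mpr h
  have h1 : ¬ LinearIndependent L ![crossProduct u v, y] := by
    rw [← crossProduct_ne_zero_iff_linearIndependent, not_not, cross_cross_eq_smul_sub_smul,
      dotProduct_comm u y, dotProduct_comm v y, hu, hv, zero_smul, zero_smul, sub_zero]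
  rw [LinearIndependent.pair_iff' h0] at h1
  push Not at h1
  obtain ⟨c, hc⟩ := h1
  exact ⟨c, hc.symm⟩

theorem exists_rightInverse_and_ker_of_rank {M : Matrix (Fin 3) (Fin 4) ℂ} (hM : M.rank = 3)
    {O : Fin 4 → ℂ} (hO : O ≠ 0) (hMO : M.mulVec O = 0) :
    (∃ N : Matrix (Fin 4) (Fin 3) ℂ, M * N = 1) ∧ ∀ v, M.mulVec v = 0 → ∃ c : ℂ, v = c • O := by
  have h1 : Module.finrank ℂ (LinearMap.range M.mulVecLin) = 3 := hM
  have h2 := LinearMap.finrank_range_add_finrank_ker M.mulVecLin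
  rw [h1, Module.finrank_fin_fun] at h2
  have h3 : Module.finrank ℂ (LinearMap.ker M.mulVecLin) = 1 := by omega
  constructor
  · rw [← Matrix.mulVec_surjective_iff_exists_right_inverse]
    have := Submodule.eq_top_of_finrank_eq (K := ℂ) (S := LinearMap.range M.mulVecLin)
      (by rw [h1, Module.finrank_fin_fun])
    exact LinearMap.range_eq_top.mp this
  · intro v hv
    obtain ⟨c, hc⟩ := (finrank_eq_one_iff_of_nonzero' (⟨O, hMO⟩ : LinearMap.ker M.mulVecLin)
      (fun h => hO (congrArg Subtype.val h))).mp h3 ⟨v, hv⟩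
    exact ⟨c, (congrArg Subtype.val hc).symm⟩

end Auxiliary

/-! ### General projections and the dual of the image curve. -/

namespace SpaceCurve

variable {X : Set (PSpace 4)}

namespace TangentFrame

variable (fr : TangentFrame X)

/-- Conditions on a projection to the plane that hold when its centre is general. -/
structure IsGeneralProjection (F : MvPolynomial (Fin 4) ℂ) (M : Matrix (Fin 3) (Fin 4) ℂ) :
    Prop where
  mulVec_ne_zero : ∀ v ∈ affineCone X, v ≠ 0 → M.mulVec v ≠ 0
  linearIndependent : ∀ p ∈ cone X, aeval p fr.g ≠ 0 →
    LinearIndependent ℂ ![M.mulVec p, M.mulVec (fr.tau p)]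
  not_dvd : ∀ Ψ, Prime Ψ → Ψ ∣ linSubst M.transpose F →
    ¬ Ψ ∣ linSubst M.transpose (aeval (fun i => pderiv i F) fr.g)

/-- `G` is a product of three forms: `B` keeps `O` off the tangent lines at good points, `f` keeps
it off `X`, and `Λ` keeps components of the section out of the bad locus. -/
theorem exists_polynomial_isGeneralProjection (hX : IsIrreducibleCurve X)
    {F : MvPolynomial (Fin 4) ℂ} (hF : fr.IsDualEquation F) :
    ∃ G : MvPolynomial (Fin 4) ℂ, G ≠ 0 ∧ G.IsHomogeneous G.totalDegree ∧
      ∀ (M : Matrix (Fin 3) (Fin 4) ℂ) (O : Fin 4 → ℂ), O ≠ 0 → M.rank = 3 → M.mulVec O = 0 →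
        aeval O G ≠ 0 → O ∉ affineCone X ∧ fr.IsGeneralProjection F M := by
  obtain ⟨B, hB0, ⟨dB, hBh⟩, hB⟩ := fr.exists_equation_tangentDevelopable hX
  obtain ⟨f, hfX, hf0, df, hfh⟩ := fr.exists_isHomogeneous_mem_idealOf
  obtain ⟨Λ, hΛ0, ⟨dΛ, hΛh⟩, hΛ⟩ := exists_polynomial_linearForm_notMem_minimalPrimes
    (Ideal.span {F, aeval (fun i => pderiv i F) fr.g})
  have hG0 : B * f * Λ ≠ 0 := mul_ne_zero (mul_ne_zero hB0 hf0) hΛ0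
  have hGh := (hBh.mul hfh).mul hΛh
  refine ⟨B * f * Λ, hG0, by rwa [hGh.totalDegree hG0], fun M O hO hM hMO hG => ?_⟩
  rw [map_mul, map_mul] at hG
  have hOΛ := right_ne_zero_of_mul hG
  have hOf := right_ne_zero_of_mul (left_ne_zero_of_mul hG)
  have hOB := left_ne_zero_of_mul (left_ne_zero_of_mul hG)
  have hOX : O ∉ affineCone X := fun h => hOf (h f hfX)
  obtain ⟨⟨N, hMN⟩, hker⟩ := exists_rightInverse_and_ker_of_rank hM hO hMO
  have hne : ∀ v ∈ affineCone X, v ≠ 0 → M.mulVec v ≠ 0 := by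
    intro v hv hv0 hMv
    obtain ⟨c, rfl⟩ := hker v hMv
    have hc : c ≠ 0 := left_ne_zero_of_smul hv0
    have := smul_mem_affineCone hv c⁻¹
    rw [inv_smul_smul₀ hc] at this
    exact hOX this
  refine ⟨hOX, hne, fun p hp hg => ?_, fun Ψ hΨ hdvd =>
    hF.not_dvd_linSubst fr hMN hMO (hΛ O hOΛ) hΨ hdvd⟩
  have hp' := cone_subset_affineCone X hp
  rw [LinearIndependent.pair_iff]
  intro a b hab
  rw [← Matrix.mulVec_smul, ← Matrix.mulVec_smul, ← Matrix.mulVec_add] at hab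
  obtain ⟨c, hc⟩ := hker _ hab
  -- A kernel vector `a • p + b • τ = c • O` with `b ≠ 0` lies on the tangent surface; since `B` is
  -- nonzero at `O`, `c = 0`, against the independence of `p` and `τ`.
  have hb : b = 0 := by
    by_contra hb
    have h1 := hB p hp a b hb
    rw [hc] at h1
    have h2 : c ^ dB * aeval O B = 0 := by rw [← hBh.aeval_mul]; exact h1
    have hc0 := eq_zero_of_pow_eq_zero ((mul_eq_zero.mp h2).resolve_right hOB)
    rw [hc0, zero_smul] at hc
    exact hb ((LinearIndependent.pair_iff.mp (fr.linearIndependent_τ p hg) a b hc).2)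
  refine ⟨?_, hb⟩
  by_contra ha
  rw [hb, zero_smul, add_zero] at hab
  exact hne _ (smul_mem_affineCone hp' a) (smul_ne_zero ha (fr.ne_zero_of_good hg)) hab

end TangentFrame

theorem mem_cone_imageCurve {M : Matrix (Fin 3) (Fin 4) ℂ} {y : Fin 3 → ℂ} :
    y ∈ cone (imageCurve M X) ↔ y ≠ 0 ∧ ∃ v ∈ cone X, M.mulVec v = y := by
  constructor
  · rintro ⟨hy, v, hv, h, heq⟩
    obtain ⟨c, hc⟩ := (Projectivization.mk_eq_mk_iff' ℂ _ _ hy h).mp heq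
    refine ⟨hy, c • v, smul_mem_cone hv ?_, by rw [Matrix.mulVec_smul, hc]⟩
    rintro rfl
    exact hy (by rw [← hc, zero_smul])
  · rintro ⟨hy, v, hv, rfl⟩
    exact ⟨hy, v, hv, hy, rfl⟩

namespace TangentFrame

namespace IsGeneralProjection

variable {fr : TangentFrame X} {F : MvPolynomial (Fin 4) ℂ} {M : Matrix (Fin 3) (Fin 4) ℂ}
  (h : fr.IsGeneralProjection F M)

include h

theorem mulVec_mem_cone {v : Fin 4 → ℂ} (hv : v ∈ cone X) : M.mulVec v ∈ cone (imageCurve M X) :=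
  mem_cone_imageCurve.mpr ⟨h.mulVec_ne_zero v (cone_subset_affineCone X hv) hv.1, v, hv, rfl⟩

theorem mem_idealOf_imageCurve {f : MvPolynomial (Fin 3) ℂ} :
    f ∈ idealOf (imageCurve M X) ↔ linSubst M f ∈ idealOf X := by
  have key : ∀ v : Fin 4 → ℂ, aeval v (linSubst M f) = aeval (M.mulVec v) f := by
    intro v
    rw [aeval_linSubst]
    simp [Algebra.algebraMap_self]
  constructor
  · intro hf v hv
    rw [key]
    exact hf _ (h.mulVec_mem_cone hv)
  · intro hf y hy
    obtain ⟨-, v, hv, rfl⟩ := mem_cone_imageCurve.mp hy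
    rw [← key]
    exact hf v hv

/-- Two independent tangent vectors at the generic image point give dimension at least 2, and three
coordinates inside a ring of dimension 2 are dependent. If all partials vanished there, the tangent
space would be 3-dimensional. -/
theorem exists_pderiv_notMem_and_ringKrullDim_eq (hX : IsIrreducibleCurve X) :
    (∃ f ∈ idealOf (imageCurve M X), ∃ i, linSubst M (pderiv i f) ∉ idealOf X) ∧
      ringKrullDim (CoordRing (imageCurve M X)) = 2 := by
  have hI := hX.irreducible
  have hcomap : idealOf (imageCurve M X) = (idealOf X).comap (linSubst M) :=
    Ideal.ext fun f => h.mem_idealOf_imageCurve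
  have hprime : (idealOf (imageCurve M X)).IsPrime := by rw [hcomap]; infer_instance
  obtain ⟨K, _, _, x, hx, -⟩ := hI.exists_genericPoint
  have : CharZero K := charZero_of_injective_algebraMap (algebraMap ℂ K).injective
  let M' := M.map (algebraMap ℂ K)
  let z : Fin 3 → K := M'.mulVec x
  have hz : ∀ f, f ∈ idealOf (imageCurve M X) ↔ aeval z f = 0 := by
    intro f
    rw [h.mem_idealOf_imageCurve, hx, aeval_linSubst]
  have hx0 : ∀ f ∈ idealOf X, aeval x f = 0 := fun f hf => (hx f).mp hf
  have hind : LinearIndependent K ![z, M'.mulVec (fr.tau x)] := by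
    obtain ⟨p, hp, hg⟩ := exists_mem_cone_ne_zero fr.g_notMem
    obtain ⟨a, b, hab⟩ := exists_minor_ne_zero (h.linearIndependent p hp hg)
    let l : Fin 3 → MvPolynomial (Fin 4) ℂ := fun i => ∑ j, C (M i j) * MvPolynomial.X j
    let t : Fin 3 → MvPolynomial (Fin 4) ℂ := fun i => ∑ j, C (M i j) * fr.τ j
    refine linearIndependent_pair_of_minor_ne_zero (a := a) (b := b) fun h0 => hab ?_
    have h1 : l a * t b - l b * t a ∈ idealOf X := by
      rw [hx, ← h0]
      simp [l, t, z, M', Matrix.mulVec, dotProduct, tau]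
    have h2 := h1 p hp
    rw [← h2]
    simp [l, t, Matrix.mulVec, dotProduct, tau]
  have hle : (2 : WithBot ℕ∞) ≤ ringKrullDim (CoordRing (imageCurve M X)) := by
    have h1 := finrank_le_ringKrullDim_quotient z _ hz
      (Submodule.span K (Set.range ![z, M'.mulVec (fr.tau x)])) (by
        intro w hw f hf
        induction hw using Submodule.span_induction with
        | mem w hw =>
          obtain ⟨b, rfl⟩ := hw
          fin_cases b
          · exact gradAt_dotProduct_self (fun f hf => (hz f).mp hf) hf
          · change gradAt z f ⬝ᵥ M'.mulVec (fr.tau x) = 0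
            rw [Matrix.dotProduct_mulVec, ← gradAt_linSubst]
            exact fr.gradAt_dotProduct_tau hx0 (h.mem_idealOf_imageCurve.mp hf)
        | zero => simp
        | add v w _ _ hv hw => rw [dotProduct_add, hv, hw, add_zero]
        | smul c v _ hv => rw [dotProduct_smul, hv, smul_zero])
    rw [finrank_span_eq_card hind, Fintype.card_fin] at h1
    exact h1
  have hbot : ∃ f ∈ idealOf (imageCurve M X), f ≠ 0 := by
    by_contra! hcon
    have hy : AlgebraicIndependent ℂ fun i : Fin 3 =>
        Ideal.Quotient.mk (idealOf X) (linSubst M (MvPolynomial.X i)) := by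
      refine (injective_iff_map_eq_zero _).mpr fun q hq => hcon q ?_
      rw [h.mem_idealOf_imageCurve, ← Ideal.Quotient.eq_zero_iff_mem, ← hq,
        ← Ideal.Quotient.mkₐ_eq_mk ℂ, ← AlgHom.comp_apply]
      congr 1
      ext i
      simp
    have h1 := hy.natCast_le_ringKrullDim
    rw [hX.dim_eq] at h1
    have h2 : ((3 : ℕ) : WithBot ℕ∞) ≤ ((2 : ℕ) : WithBot ℕ∞) := h1
    rw [Nat.cast_le] at h2
    omega
  obtain ⟨f₀, hf₀, hf₀0⟩ := hbot
  have hdim : ringKrullDim (CoordRing (imageCurve M X)) + 1 ≤ 3 := by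
    have h1 := ringKrullDim_succ_le_of_surjective (Ideal.Quotient.mk (idealOf (imageCurve M X)))
      Ideal.Quotient.mk_surjective (mem_nonZeroDivisors_of_ne_zero hf₀0)
      (Ideal.Quotient.eq_zero_iff_mem.mpr hf₀)
    rw [MvPolynomial.ringKrullDim_of_isNoetherianRing, ringKrullDim_eq_zero_of_field, zero_add,
      Nat.card_fin] at h1
    exact h1
  have heq : ringKrullDim (CoordRing (imageCurve M X)) = 2 := by
    refine le_antisymm ?_ hle
    rw [← ENat.WithBot.add_le_add_one_right_iff]
    exact hdim.trans_eq (by norm_num)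
  refine ⟨?_, heq⟩
  by_contra! hcon
  have h1 := finrank_le_ringKrullDim_quotient z _ hz ⊤ (by
    intro w _ f hf
    have : gradAt z f = 0 := by
      ext i
      have h2 := (hx _).mp (hcon f hf i)
      rwa [aeval_linSubst] at h2
    rw [this, zero_dotProduct])
  rw [finrank_top, Module.finrank_fin_fun] at h1
  change _ ≤ ringKrullDim (CoordRing (imageCurve M X)) at h1
  rw [heq] at h1
  have h2 : ((3 : ℕ) : WithBot ℕ∞) ≤ ((2 : ℕ) : WithBot ℕ∞) := h1
  rw [Nat.cast_le] at h2
  omega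

theorem mem_tangentAt_imageCurve {p : Fin 4 → ℂ} (hp : p ∈ cone X) :
    M.mulVec p ∈ tangentAt (imageCurve M X) (M.mulVec p) ∧
      M.mulVec (fr.tau p) ∈ tangentAt (imageCurve M X) (M.mulVec p) := by
  refine ⟨self_mem_tangentAt (cone_subset_affineCone _ (h.mulVec_mem_cone hp)), fun f hf => ?_⟩
  have h1 := gradAt_linSubst M p f
  rw [Algebra.algebraMap_self, RingHom.coe_id, Matrix.map_id] at h1
  rw [Matrix.dotProduct_mulVec, ← h1]
  exact fr.gradAt_dotProduct_tau (cone_subset_affineCone X hp) (h.mem_idealOf_imageCurve.mp hf)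

/-- The tangent lines of the image curve at the images of all points, in dual coordinates. -/
theorem crossProduct_mem_affineCone (hX : IsIrreducibleCurve X) {p : Fin 4 → ℂ}
    (hp : p ∈ cone X) : crossProduct (M.mulVec p) (M.mulVec (fr.tau p)) ∈
      affineCone (tangentHyperplanes (imageCurve M X)) := by
  intro H hH
  obtain ⟨⟨f, hf, i, hs⟩, hdim⟩ := h.exists_pderiv_notMem_and_ringKrullDim_eq hX
  let l : Fin 3 → MvPolynomial (Fin 4) ℂ := fun i => ∑ j, C (M i j) * MvPolynomial.X j
  let t : Fin 3 → MvPolynomial (Fin 4) ℂ := fun i => ∑ j, C (M i j) * fr.τ j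
  have key : ∀ p : Fin 4 → ℂ, aeval p (aeval (crossProduct l t) H) =
      aeval (crossProduct (M.mulVec p) (M.mulVec (fr.tau p))) H := by
    intro p
    rw [aeval_aeval]
    congr 2
    ext i
    fin_cases i <;> simp [cross_apply, l, t, Matrix.mulVec, dotProduct, tau]
  rw [← key]
  -- Where `g` and the chosen partial are nonzero, the image point is smooth with tangent plane
  -- spanned by `M p` and `M τ(p)`. Density covers the remaining points.
  refine mem_idealOf_of_forall_ne_zero hX.irreducible (s := fr.g * linSubst M (pderiv i f))
    (fun hmem => (hX.irreducible.mem_or_mem hmem).elim fr.g_notMem hs) (fun p hp hgs => ?_) p hp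
  rw [map_mul] at hgs
  have hg := left_ne_zero_of_mul hgs
  have hsp := right_ne_zero_of_mul hgs
  have hind := h.linearIndependent p hp hg
  obtain ⟨hm1, hm2⟩ := h.mem_tangentAt_imageCurve hp
  have hgrad : gradAt (M.mulVec p) f ≠ 0 := fun h0 => hsp (by
    rw [aeval_linSubst, Algebra.algebraMap_self, RingHom.coe_id, Matrix.map_id]
    exact congrFun h0 i)
  have hle : Submodule.span ℂ (Set.range ![M.mulVec p, M.mulVec (fr.tau p)]) ≤
      tangentAt (imageCurve M X) (M.mulVec p) := by
    rw [Submodule.span_le]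
    rintro w ⟨b, rfl⟩
    fin_cases b
    exacts [hm1, hm2]
  have hfin : Module.finrank ℂ (tangentAt (imageCurve M X) (M.mulVec p)) ≤ 2 := by
    have := finrank_add_le_of_orthogonal (u := ![gradAt (M.mulVec p) f])
      (LinearIndependent.of_subsingleton 0 hgrad) (tangentAt (imageCurve M X) (M.mulVec p))
      (fun w hw a => by fin_cases a; exact hw f hf)
    omega
  have hspan : Module.finrank ℂ
      (Submodule.span ℂ (Set.range ![M.mulVec p, M.mulVec (fr.tau p)])) = 2 := by
    rw [finrank_span_eq_card hind, Fintype.card_fin]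
  have heq := Submodule.eq_of_le_of_finrank_le hle (by rwa [hspan])
  rw [key]
  refine hH _ (mem_cone_tangentHyperplanes.mpr
    ⟨crossProduct_ne_zero_iff_linearIndependent.mpr hind, M.mulVec p, h.mulVec_mem_cone hp, ?_,
      fun w hw => ?_⟩)
  · rw [← heq, hspan, hdim]; rfl
  · rw [← heq] at hw
    induction hw using Submodule.span_induction with
    | mem w hw =>
      obtain ⟨b, rfl⟩ := hw
      fin_cases b
      · rw [dotProduct_comm]; exact dot_self_cross _ _
      · rw [dotProduct_comm]; exact dot_cross_self _ _
    | zero => simp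
    | add v w _ _ hv hw => rw [dotProduct_add, hv, hw, add_zero]
    | smul c v _ hv => rw [dotProduct_smul, hv, smul_zero]

/-- A tangent line of the image is a gradient `∇f(M p)`, and `Mᵀ` sends it to the gradient at `p` of
the equation `f ∘ M` of `X`. -/
theorem linSubst_transpose_mem (hX : IsIrreducibleCurve X) (hF : fr.IsDualEquation F) :
    linSubst M.transpose F ∈ idealOf (tangentHyperplanes (imageCurve M X)) := by
  intro y hy
  obtain ⟨-, v, hv, -, horth⟩ := mem_cone_tangentHyperplanes.mp hy
  obtain ⟨f, hf, rfl⟩ := exists_gradAt_eq_of_orthogonal_tangentAt horth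
  obtain ⟨-, p, hp, rfl⟩ := mem_cone_imageCurve.mp hv
  have hFJ : F ∈ idealOf (tangentHyperplanes X) := by
    rw [hF.idealOf_eq]; exact Ideal.mem_span_singleton_self F
  have h1 := fr.aeval_gradAt_eq_zero hX ((fr.mem_idealOf_tangentHyperplanes hX F).mp hFJ)
    (h.mem_idealOf_imageCurve.mp hf) hp
  rw [gradAt_linSubst, Algebra.algebraMap_self, RingHom.coe_id, Matrix.map_id] at h1
  rw [aeval_linSubst, Algebra.algebraMap_self, RingHom.coe_id, Matrix.map_id,
    Matrix.mulVec_transpose]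
  exact h1

omit h in
/-- The contact points, on the space curve, of a general tangent line of the image curve. -/
theorem exists_contact (hX : IsIrreducibleCurve X) (hF : fr.IsDualEquation F) {y : Fin 3 → ℂ}
    (hy : aeval y (linSubst M.transpose F) = 0)
    (hQ : aeval y (linSubst M.transpose (aeval (fun i => pderiv i F) fr.g)) ≠ 0) :
    ∃ p ∈ cone X, aeval p fr.g ≠ 0 ∧ gradAt y (linSubst M.transpose F) = M.mulVec p ∧
      y ⬝ᵥ M.mulVec p = 0 ∧ y ⬝ᵥ M.mulVec (fr.tau p) = 0 := by
  rw [aeval_linSubst, Algebra.algebraMap_self, RingHom.coe_id, Matrix.map_id] at hy hQ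
  rw [aeval_aeval] at hQ
  change aeval (gradAt (M.transpose.mulVec y) F) fr.g ≠ 0 at hQ
  refine ⟨gradAt (M.transpose.mulVec y) F, mem_cone_of_mem_affineCone hX.closed
    (hF.gauss_mem _ hy) (fr.ne_zero_of_good hQ), hQ, mulVec_gradAt_linSubst_transpose M y F, ?_, ?_⟩
  · rw [Matrix.dotProduct_mulVec, ← Matrix.mulVec_transpose]
    exact hF.gauss_self _ hy
  · rw [Matrix.dotProduct_mulVec, ← Matrix.mulVec_transpose]
    exact hF.gauss_tau _ hy

theorem gradAt_linSubst_ne_zero (hX : IsIrreducibleCurve X) (hF : fr.IsDualEquation F)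
    {y : Fin 3 → ℂ} (hy : aeval y (linSubst M.transpose F) = 0)
    (hQ : aeval y (linSubst M.transpose (aeval (fun i => pderiv i F) fr.g)) ≠ 0) :
    gradAt y (linSubst M.transpose F) ≠ 0 := by
  obtain ⟨p, hp, -, hgrad, -, -⟩ := exists_contact hX hF hy hQ
  rw [hgrad]
  exact (h.mulVec_mem_cone hp).1

/-- Were it zero, every prime would divide it, so the bad-locus equation would survive the
substitution. At a point where that is nonzero the gradient cannot vanish. -/
theorem linSubst_transpose_ne_zero (hX : IsIrreducibleCurve X) (hF : fr.IsDualEquation F) :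
    linSubst M.transpose F ≠ 0 := by
  intro h0
  have hQ : linSubst M.transpose (aeval (fun i => pderiv i F) fr.g) ≠ 0 := fun hQ =>
    h.not_dvd (MvPolynomial.X 0) X_prime (by rw [h0]; exact dvd_zero _)
      (by rw [hQ]; exact dvd_zero _)
  obtain ⟨y, hy⟩ : ∃ y : Fin 3 → ℂ,
      aeval y (linSubst M.transpose (aeval (fun i => pderiv i F) fr.g)) ≠ 0 := by
    by_contra! hcon
    exact hQ (MvPolynomial.funext fun y => by rw [map_zero]; exact hcon y)
  refine h.gradAt_linSubst_ne_zero hX hF (by rw [h0, map_zero]) hy ?_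
  ext i
  simp [h0]

/-- A double factor `Ψ` would kill the gradient along `Ψ = 0`, putting that component in the bad
locus. For a simple factor, points off the bad locus are multiples of `M p × M τ(p)`, where `H`
vanishes; so `Ψ` divides `H`. -/
theorem idealOf_tangentHyperplanes_imageCurve (hX : IsIrreducibleCurve X)
    (hF : fr.IsDualEquation F) :
    idealOf (tangentHyperplanes (imageCurve M X)) = Ideal.span {linSubst M.transpose F} := by
  refine le_antisymm (fun H hH => ?_)
    ((Ideal.span_singleton_le_iff_mem _).mpr (h.linSubst_transpose_mem hX hF))
  rw [Ideal.mem_span_singleton]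
  refine dvd_of_forall_prime_dvd (h.linSubst_transpose_ne_zero hX hF) (fun Ψ hΨ hdvd hsq => ?_)
    fun Ψ hΨ hdvd => ?_
  · refine h.not_dvd Ψ hΨ hdvd (dvd_of_forall_aeval_eq_zero hΨ fun y hy => ?_)
    by_contra hQ
    obtain ⟨u, hu⟩ := hsq
    refine h.gradAt_linSubst_ne_zero hX hF ?_ hQ ?_
    · rw [hu, map_mul, map_mul, hy, zero_mul, zero_mul]
    · rw [hu, mul_assoc, gradAt_mul, map_mul, hy, gradAt_mul, hy]
      simp
  · refine (hΨ.dvd_or_dvd (dvd_of_forall_aeval_eq_zero (f := linSubst M.transpose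
      (aeval (fun i => pderiv i F) fr.g) * H) hΨ fun y hy => ?_)).resolve_left
      (h.not_dvd Ψ hΨ hdvd)
    rw [map_mul]
    by_cases hQ : aeval y (linSubst M.transpose (aeval (fun i => pderiv i F) fr.g)) = 0
    · rw [hQ, zero_mul]
    · have hy' : aeval y (linSubst M.transpose F) = 0 := by
        obtain ⟨u, hu⟩ := hdvd
        rw [hu, map_mul, hy, zero_mul]
      obtain ⟨p, hp, hg, -, h1, h2⟩ := exists_contact hX hF hy' hQ
      obtain ⟨c, rfl⟩ := exists_eq_smul_crossProduct (h.linearIndependent p hp hg) h1 h2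
      rw [smul_mem_affineCone (h.crossProduct_mem_affineCone hX hp) c H hH, mul_zero]

end IsGeneralProjection

end TangentFrame

end SpaceCurve

theorem mainTheorem6 (X : Set (SpaceCurve.PSpace 4))
    (hX : SpaceCurve.IsIrreducibleCurve X) (hline : ¬ SpaceCurve.IsLine X) :
    SpaceCurve.IsHypersurface (SpaceCurve.dualVariety X) ∧
    ∃ m : ℕ,
      (∀ Υ : MvPolynomial (Fin 4) ℂ,
        SpaceCurve.IsMinimalDefiningPolynomial Υ (SpaceCurve.dualVariety X) →
          Υ.totalDegree = m) ∧
      -- for a generic camera centre `O`, the dual image curve is a curve, of degree `m`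
      ∃ G : MvPolynomial (Fin 4) ℂ, G ≠ 0 ∧ G.IsHomogeneous G.totalDegree ∧
        ∀ (M : Matrix (Fin 3) (Fin 4) ℂ) (O : Fin 4 → ℂ) (hO : O ≠ 0),
          M.rank = 3 → M.mulVec O = 0 → MvPolynomial.eval O G ≠ 0 →
            Projectivization.mk ℂ O hO ∉ X ∧
            SpaceCurve.IsHypersurface (SpaceCurve.dualVariety (SpaceCurve.imageCurve M X)) ∧
            SpaceCurve.curveClass (SpaceCurve.imageCurve M X) = m := by
  obtain ⟨fr⟩ := hX.nonempty_tangentFrame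
  obtain ⟨F, hF⟩ := fr.exists_isDualEquation hX hline
  obtain ⟨G, hG0, hGh, hG⟩ := fr.exists_polynomial_isGeneralProjection hX hF
  refine ⟨⟨F, SpaceCurve.isDefiningPolynomial_of_idealOf_eq_span hF.idealOf_eq hF.prime.ne_zero,
    hF.degree_pos⟩, F.totalDegree, fun Υ hΥ =>
    SpaceCurve.totalDegree_eq_of_isMinimalDefiningPolynomial hF.idealOf_eq hF.prime.ne_zero hΥ,
    G, hG0, hGh, fun M O hO hM hMO hGO => ?_⟩
  obtain ⟨hOX, hgen⟩ := hG M O hO hM hMO hGO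
  have hspan := hgen.idealOf_tangentHyperplanes_imageCurve hX hF
  have hne := hgen.linSubst_transpose_ne_zero hX hF
  have hdeg : (linSubst M.transpose F).totalDegree = F.totalDegree :=
    (linSubst_isHomogeneous _ (SpaceCurve.isHomogeneous_of_idealOf_eq_span hF.idealOf_eq
      hF.prime.ne_zero)).totalDegree hne
  refine ⟨fun hmem => hOX (SpaceCurve.cone_subset_affineCone X ⟨hO, hmem⟩),
    ⟨_, SpaceCurve.isDefiningPolynomial_of_idealOf_eq_span hspan hne, hdeg ▸ hF.degree_pos⟩, ?_⟩
  rw [← hdeg]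
  exact SpaceCurve.hypersurfaceDegree_eq hspan hne
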